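/- Let $\mathcal N$ be a finite non-empty set of operators. The transmitters of operator $j\in\mathcal N$ form a homogeneous Poisson point process $\Phi_j$ on $\mathbb R^2$ with intensity $\lambda_j>0$, the processes of different operators being independent; $\Phi=\bigcup_{j}\Phi_j$. Each operator holds one spectrum band, so that the bands are also indexed by $\mathcal N$. In the full sharing scenario all transmitters use all bands, and a reference user (of any operator $n\in\mathcal N$) at the origin is served by the transmitter $x\in\Phi$ closest to it. With path loss $\|y\|^{-\alpha}$, $\alpha>2$, and power fadings $h_y^k$ (transmitter $y$, band $k$) that are exponential with unit mean, independent over all transmitters and all bands (frequency-selective Rayleigh fading) and independent of the locations, the signal-to-interference-and-noise ratio in band $k$ is $$\mathrm{SINR}_k=\frac{h_x^k\|x\|^{-\alpha}}{\eta W+\sum_{y\in\Phi\setminus\{x\}}h_y^k\|y\|^{-\alpha}},\qquad W\ge 0,\ \eta>0,$$ where $W$ is the noise power and $\eta$ accounts for power splitting across bands ($\eta=|\mathcal N|$ for an equal split; $\eta=1$ when $W$ already denotes the noise power relative to the transmit power per band). The coverage probability at threshold $\theta>0$ is the probability that the threshold is exceeded in at least one band, $p_n(\theta)=\mathbb P\big(\bigcup_{k\in\mathcal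 N}\{\mathrm{SINR}_k>\theta\}\big)$. Then, with all integrals convergent, $$p_n(\theta)=\pi\Big(\sum_{i\in\mathcal N}\lambda_i\Big)\sum_{k=1}^{|\mathcal N|}\binom{|\mathcal N|}{k}(-1)^{k+1}\int_0^\infty \exp\!\big(-\theta r^{\alpha/2}k\,\eta W\big)\exp\!\Big(-\pi r\sum_{j\in\mathcal N}\lambda_j\Big(1+\sum_{l=1}^{k}\binom{k}{l}(-1)^{l+1}\mathfrak Z(\theta,\alpha,l)\Big)\Big)\,dr,$$ where $$\mathfrak Z(\theta,\alpha,l)=\frac{2\theta^l}{l\alpha-2}\;{}_2F_1\big(l,\,l-2/\alpha;\;l-2/\alpha+1;\;-\theta\big)$$ and ${}_2F_1$ is the Gauss hypergeometric function (analytically continued to $(-\infty,1)$). -/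

import Mathlib

open MeasureTheory ProbabilityTheory
open scoped ENNReal

/-! ### The Gauss hypergeometric function on `(-∞, 1)` -/

/-- The Gauss hypergeometric function `₂F₁(a, b; c; z)` for real `z < 1`: the real-analytic
continuation to `(-∞, 1)` of the hypergeometric series, which converges for `|z| < 1`.
(Mathlib's `₂F₁` is only the sum of the series, with the value `0` where it diverges.) -/
noncomputable def gaussHypergeometric (a b c z : ℝ) : ℝ :=
  open Classical in
  if h : ∃ F : ℝ → ℝ, AnalyticOnNhd ℝ F (Set.Iio 1) ∧
      Set.EqOn F (fun x => ₂F₁ a b c x) (Set.Ioo (-1) 1)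
  then h.choose z else 0

/-- Euler's integral for `c = b + 1`. -/
noncomputable def eulerIntegral (a b z : ℝ) : ℝ :=
  b * ∫ t in Set.Ioc (0 : ℝ) 1, t ^ (b - 1) * (1 - z * t) ^ (-a)

/-- Taylor coefficients of Euler's integral at the point `z`. -/
noncomputable def eulerCoeff (a b z : ℝ) (n : ℕ) : ℝ :=
  b * ∫ t in Set.Ioc (0 : ℝ) 1, t ^ (b - 1) * (1 - z * t) ^ (-a) *
    (Ring.choose (a + n - 1) n * (t / (1 - z * t)) ^ n)

theorem hasSum_one_sub_rpow (a : ℝ) {x : ℝ} (hx : |x| < 1) :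
    HasSum (fun n : ℕ => Ring.choose (a + n - 1) n * x ^ n) ((1 - x) ^ (-a)) ∧
    Summable (fun n : ℕ => |Ring.choose (a + n - 1) n| * |x| ^ n) := by
  have h := Real.one_div_one_sub_rpow_hasFPowerSeriesOnBall_zero a
  have hx' : x ∈ Metric.eball (0 : ℝ) 1 := by
    rw [Metric.mem_eball, edist_zero_right, Real.enorm_eq_ofReal_abs]
    simpa using hx
  constructor
  · have h2 := h.hasSum hx'
    simp only [FormalMultilinearSeries.ofScalars_apply_eq, smul_eq_mul, zero_add] at h2
    rw [Real.rpow_neg (by linarith [(abs_lt.1 hx).2]), ← one_div]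
    exact h2
  · have h3 : ((‖x‖₊ : NNReal) : ENNReal) < (FormalMultilinearSeries.ofScalars ℝ
        (fun n : ℕ => Ring.choose (a + n - 1) n)).radius := by
      refine lt_of_lt_of_le ?_ h.r_le
      rw [ENNReal.coe_lt_one_iff, ← NNReal.coe_lt_coe]
      simpa using hx
    have h4 := FormalMultilinearSeries.summable_norm_mul_pow _ h3
    simpa [FormalMultilinearSeries.ofScalars_norm] using h4

theorem integrable_euler (a : ℝ) {b z : ℝ} (hb : 0 < b) (hz : z < 1) :
    IntegrableOn (fun t : ℝ => t ^ (b - 1) * (1 - z * t) ^ (-a)) (Set.Ioc 0 1) := by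
  have h1 : IntegrableOn (fun t : ℝ => t ^ (b - 1)) (Set.Icc 0 1) := by
    rw [integrableOn_Icc_iff_integrableOn_Ioc,
      ← intervalIntegrable_iff_integrableOn_Ioc_of_le zero_le_one]
    exact intervalIntegral.intervalIntegrable_rpow' (by linarith)
  refine (h1.mul_continuousOn ?_ isCompact_Icc).mono_set Set.Ioc_subset_Icc_self
  refine ContinuousOn.rpow_const (by fun_prop) fun t ht => Or.inl ?_
  rcases le_or_gt z 0 with h | h
  · nlinarith [ht.1, mul_nonneg (neg_nonneg.2 h) ht.1]
  · nlinarith [ht.1, ht.2]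

theorem hasSum_euler (a : ℝ) {b z y : ℝ} (hb : 0 < b) (hz : z < 1) (hy : |y| < 1 - z) :
    HasSum (fun n : ℕ => eulerCoeff a b z n * y ^ n) (eulerIntegral a b (z + y)) ∧
    Summable (fun n : ℕ => |eulerCoeff a b z n| * |y| ^ n) := by
  have hz' : 0 < 1 - z := by linarith
  have hd : ∀ t ∈ Set.Ioc (0 : ℝ) 1, 0 < 1 - z * t := by
    intro t ht
    nlinarith [ht.1, ht.2, mul_pos hz' ht.1]
  have hu : ∀ t ∈ Set.Ioc (0 : ℝ) 1,
      0 ≤ t / (1 - z * t) ∧ |y| * (t / (1 - z * t)) ≤ |y| / (1 - z) := by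
    intro t ht
    refine ⟨div_nonneg ht.1.le (hd t ht).le, ?_⟩
    rw [div_eq_mul_inv |y|]
    refine mul_le_mul_of_nonneg_left ?_ (abs_nonneg y)
    rw [inv_eq_one_div, div_le_div_iff₀ (hd t ht) hz']
    nlinarith [ht.1, ht.2]
  set q : ℝ := |y| / (1 - z) with hq
  have hq0 : 0 ≤ q := div_nonneg (abs_nonneg y) hz'.le
  have hq1 : |q| < 1 := by
    rw [abs_of_nonneg hq0, hq, div_lt_one hz']; exact hy
  have hI := integrable_euler a hb hz
  set w : ℝ → ℝ := fun t => t ^ (b - 1) * (1 - z * t) ^ (-a) with hw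
  set A : ℕ → ℝ := fun n => Ring.choose (a + n - 1) n with hA
  have hsA : Summable (fun n => |A n| * q ^ n) := by
    have := (hasSum_one_sub_rpow a hq1).2
    rwa [abs_of_nonneg hq0] at this
  set F : ℕ → ℝ → ℝ := fun n t => w t * (A n * (t / (1 - z * t)) ^ n) * y ^ n with hF
  have hbound : ∀ n, ∀ t ∈ Set.Ioc (0 : ℝ) 1, ‖F n t‖ ≤ ‖w t‖ * (|A n| * q ^ n) := by
    intro n t ht
    simp only [hF, norm_mul, norm_pow, Real.norm_eq_abs]
    rw [abs_of_nonneg (hu t ht).1]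
    have : (|y| * (t / (1 - z * t))) ^ n ≤ q ^ n :=
      pow_le_pow_left₀ (mul_nonneg (abs_nonneg y) (hu t ht).1) (hu t ht).2 n
    calc |w t| * (|A n| * (t / (1 - z * t)) ^ n) * |y| ^ n
        = |w t| * (|A n| * (|y| * (t / (1 - z * t))) ^ n) := by rw [mul_pow]; ring
      _ ≤ _ := by gcongr
  have hmeas : ∀ n, AEStronglyMeasurable (F n) (volume.restrict (Set.Ioc (0 : ℝ) 1)) := by
    intro n
    apply Measurable.aestronglyMeasurable
    simp only [hF, hw]
    fun_prop
  have hFi : ∀ n, Integrable (F n) (volume.restrict (Set.Ioc (0 : ℝ) 1)) := by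
    intro n
    refine Integrable.mono' (hI.norm.mul_const (|A n| * q ^ n)) (hmeas n) ?_
    exact (ae_restrict_iff' measurableSet_Ioc).2 (Filter.Eventually.of_forall (hbound n))
  have hint : ∀ n, ∫ t in Set.Ioc (0 : ℝ) 1, ‖F n t‖ ≤
      (∫ t in Set.Ioc (0 : ℝ) 1, ‖w t‖) * (|A n| * q ^ n) := by
    intro n
    rw [← integral_mul_const]
    exact setIntegral_mono_on (hFi n).norm (hI.norm.mul_const _) measurableSet_Ioc (hbound n)
  have hsum : Summable fun n => ∫ t in Set.Ioc (0 : ℝ) 1, ‖F n t‖ :=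
    Summable.of_nonneg_of_le (fun n => integral_nonneg fun t => norm_nonneg _) hint
      (hsA.mul_left _)
  have hcoef : ∀ n, eulerCoeff a b z n * y ^ n = b * ∫ t in Set.Ioc (0 : ℝ) 1, F n t := by
    intro n
    simp only [hF, eulerCoeff]
    rw [integral_mul_const, mul_assoc]
  have key := hasSum_integral_of_summable_integral_norm hFi hsum
  have hlim : ∫ t in Set.Ioc (0 : ℝ) 1, ∑' n, F n t =
      ∫ t in Set.Ioc (0 : ℝ) 1, t ^ (b - 1) * (1 - (z + y) * t) ^ (-a) := by
    refine setIntegral_congr_fun measurableSet_Ioc fun t ht => ?_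
    have hyt : |y * (t / (1 - z * t))| < 1 := by
      rw [abs_mul, abs_of_nonneg (hu t ht).1]
      rw [abs_of_nonneg hq0] at hq1
      exact lt_of_le_of_lt (hu t ht).2 hq1
    have h1 := ((hasSum_one_sub_rpow a hyt).1.mul_left (w t)).tsum_eq
    have h2 : ∀ n, F n t = w t * (Ring.choose (a + n - 1) n * (y * (t / (1 - z * t))) ^ n) := by
      intro n
      simp only [hF, hA, mul_pow]; ring
    simp only [h2]
    rw [h1]
    simp only [hw]
    rw [mul_assoc, ← Real.mul_rpow (hd t ht).le (by linarith [(abs_lt.1 hyt).2])]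
    congr 2
    have := (hd t ht).ne'
    field_simp
    ring
  constructor
  · simp only [hcoef]
    rw [eulerIntegral, ← hlim]
    exact key.mul_left b
  · have : ∀ n, |eulerCoeff a b z n| * |y| ^ n ≤ |b| * ∫ t in Set.Ioc (0 : ℝ) 1, ‖F n t‖ := by
      intro n
      rw [← abs_pow, ← abs_mul, hcoef, abs_mul]
      refine mul_le_mul_of_nonneg_left ?_ (abs_nonneg b)
      rw [← Real.norm_eq_abs]
      exact norm_integral_le_integral_norm _
    exact Summable.of_nonneg_of_le (fun n => by positivity) this (hsum.mul_left _)

theorem eulerCoeff_zero (a : ℝ) {b : ℝ} (hb : 0 < b) (n : ℕ) :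
    eulerCoeff a b 0 n = ordinaryHypergeometricCoefficient a b (b + 1) n := by
  have h1 : eulerCoeff a b 0 n = Ring.choose (a + n - 1) n * (b / (b + n)) := by
    rw [eulerCoeff]
    have : ∀ t ∈ Set.Ioc (0 : ℝ) 1, t ^ (b - 1) * (1 - 0 * t) ^ (-a) *
        (Ring.choose (a + n - 1) n * (t / (1 - 0 * t)) ^ n) =
        Ring.choose (a + n - 1) n * t ^ (b - 1 + n) := by
      intro t ht
      rw [Real.rpow_add_natCast ht.1.ne']
      simp; ring
    rw [setIntegral_congr_fun measurableSet_Ioc this, integral_const_mul,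
      ← intervalIntegral.integral_of_le zero_le_one, integral_rpow (Or.inl (by
        have : (0 : ℝ) ≤ n := n.cast_nonneg
        linarith))]
    have hbn : b + n ≠ 0 := by positivity
    rw [Real.one_rpow, Real.zero_rpow (by rw [sub_add_eq_add_sub, sub_add_cancel]; exact hbn)]
    rw [sub_add_eq_add_sub, sub_add_cancel]
    field_simp
    ring
  have h2 : Ring.choose (a + n - 1) n = (n.factorial : ℝ)⁻¹ * (ascPochhammer ℝ n).eval a := by
    have := Ring.factorial_nsmul_multichoose_eq_ascPochhammer a n
    rw [Ring.multichoose_eq, Polynomial.ascPochhammer_smeval_eq_eval, nsmul_eq_mul] at this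
    rw [← this]
    have : (n.factorial : ℝ) ≠ 0 := by positivity
    field_simp
  have h3 : ∀ m : ℕ, (ascPochhammer ℝ m).eval b * (b + m) =
      b * (ascPochhammer ℝ m).eval (b + 1) := by
    intro m
    rw [← ascPochhammer_succ_eval, ascPochhammer_succ_left]
    simp
  have h4 : 0 < (ascPochhammer ℝ n).eval (b + 1) := ascPochhammer_pos n _ (by linarith)
  have hbn : b + n ≠ 0 := by positivity
  rw [h1, h2, ordinaryHypergeometricCoefficient, mul_assoc _ (Polynomial.eval b _)]
  congr 1
  rw [← div_eq_mul_inv, div_eq_div_iff hbn h4.ne']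
  exact (h3 n).symm

theorem analyticOnNhd_eulerIntegral (a : ℝ) {b : ℝ} (hb : 0 < b) :
    AnalyticOnNhd ℝ (eulerIntegral a b) (Set.Iio 1) := by
  intro z hz
  have hz' : 0 < 1 - z := sub_pos.2 hz
  refine ⟨FormalMultilinearSeries.ofScalars ℝ (eulerCoeff a b z),
    ENNReal.ofReal ((1 - z) / 2), ?_, by simpa using hz', ?_⟩
  · refine FormalMultilinearSeries.le_radius_of_summable _ ?_
    have h := (hasSum_euler a hb hz (y := (1 - z) / 2)
      (by rw [abs_of_pos (by linarith)]; linarith)).2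
    rw [abs_of_pos (show 0 < (1 - z) / 2 by linarith)] at h
    simpa [FormalMultilinearSeries.ofScalars_norm,
      Real.coe_toNNReal _ (show 0 ≤ (1 - z) / 2 by linarith)] using h
  · intro y hy
    rw [Metric.mem_eball, edist_zero_right, Real.enorm_eq_ofReal_abs,
      ENNReal.ofReal_lt_ofReal_iff (by linarith)] at hy
    have h := (hasSum_euler a hb hz (y := y) (by linarith)).1
    simpa [FormalMultilinearSeries.ofScalars_apply_eq, mul_comm] using h

theorem eqOn_eulerIntegral (a : ℝ) {b : ℝ} (hb : 0 < b) :
    Set.EqOn (eulerIntegral a b) (fun x => ₂F₁ a b (b + 1) x) (Set.Ioo (-1) 1) := by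
  intro x hx
  have h := (hasSum_euler a hb zero_lt_one (y := x) (by simpa using abs_lt.2 hx)).1
  rw [zero_add] at h
  rw [← h.tsum_eq]
  simp only [ordinaryHypergeometric_eq_tsum, smul_eq_mul]
  exact tsum_congr fun n => by rw [eulerCoeff_zero a hb n]

/-- For the parameters used below the analytic continuation exists, and it is given by
Euler's integral. -/
theorem gaussHypergeometric_eq (a : ℝ) {b z : ℝ} (hb : 0 < b) (hz : z < 1) :
    gaussHypergeometric a b (b + 1) z =
      b * ∫ t in Set.Ioc (0 : ℝ) 1, t ^ (b - 1) * (1 - z * t) ^ (-a) := by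
  have hE : ∃ F : ℝ → ℝ, AnalyticOnNhd ℝ F (Set.Iio 1) ∧
      Set.EqOn F (fun x => ₂F₁ a b (b + 1) x) (Set.Ioo (-1) 1) :=
    ⟨_, analyticOnNhd_eulerIntegral a hb, eqOn_eulerIntegral a hb⟩
  rw [gaussHypergeometric, dif_pos hE]
  obtain ⟨h1, h2⟩ := hE.choose_spec
  have h3 := h1.eqOn_of_preconnected_of_eventuallyEq (analyticOnNhd_eulerIntegral a hb)
    isPreconnected_Iio (show (0 : ℝ) ∈ Set.Iio 1 by simp) (by
      filter_upwards [Ioo_mem_nhds (show (-1 : ℝ) < 0 by norm_num) zero_lt_one] with x hx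
      rw [h2 hx, eqOn_eulerIntegral a hb hx])
  exact h3 hz

/-- `𝔷(θ, α, l) = 2 θ ^ l / (l α - 2) · ₂F₁(l, l - 2/α; l - 2/α + 1; -θ)`. -/
noncomputable def interferenceZ (θ α : ℝ) (l : ℕ) : ℝ :=
  2 * θ ^ l / (l * α - 2) *
    gaussHypergeometric l (l - 2 / α) (l - 2 / α + 1) (-θ)

/-! ### Poisson point processes -/

/-- The Euclidean plane. -/
abbrev Plane : Type := EuclideanSpace ℝ (Fin 2)

/-- The point process with points `x 0, x 1, …`, as a counting measure: the measure of a set `B`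
is the number of indices `i` with `x i ∈ B`. -/
noncomputable def countingProcess (x : ℕ → Plane) : Measure Plane :=
  Measure.sum fun i => Measure.dirac (x i)

/-- The random measure `Φ` is a Poisson point process with intensity measure `ν`: the number of
points in a Borel set `B` with `ν B < ∞` is Poisson distributed with mean `ν B`, and the numbers of
points in pairwise disjoint Borel sets are independent. -/
structure IsPoissonProcess {Ω : Type*} [MeasurableSpace Ω] (Φ : Ω → Measure Plane)
    (ν : Measure Plane) (P : Measure Ω) : Prop where
  measurable : Measurable Φ
  hasLaw_count : ∀ B : Set Plane, MeasurableSet B → ν B ≠ ∞ →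
    HasLaw (fun ω => Φ ω B)
      ((poissonMeasure (ν B).toNNReal).map (fun m : ℕ => (m : ℝ≥0∞))) P
  indep_count : ∀ (m : ℕ) (B : Fin m → Set Plane), (∀ i, MeasurableSet (B i)) →
    Pairwise (fun i j => Disjoint (B i) (B j)) → iIndepFun (fun i ω => Φ ω (B i)) P

/-! ### The network -/

/-- A network of operators indexed by `N`, each of which also holds a licence to one spectrum band,
so that the bands are indexed by `N` as well. `X j i` is the location of the `i`-th transmitter of
operator `j`, and `h j i k` is the power fading, in band `k`, between that transmitter and the
reference user, who is located at the origin.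
The transmitters of operator `j` form a homogeneous Poisson point process of intensity `lam j`, the
processes of different operators are independent, and the fading is Rayleigh (unit-mean exponential
power), independent over all transmitters and over all bands (frequency-selective fading), and
independent of the locations. -/
structure IsSharedNetwork {N Ω : Type*} [MeasurableSpace Ω] (P : Measure Ω) (lam : N → ℝ)
    (X : N → ℕ → Ω → Plane) (h : N → ℕ → N → Ω → ℝ) : Prop where
  measurable_location : ∀ j i, Measurable (X j i)
  measurable_fading : ∀ j i k, Measurable (h j i k)
  poisson : ∀ j, IsPoissonProcess (fun ω => countingProcess fun i => X j i ω)
    (ENNReal.ofReal (lam j) • volume) P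
  indep_operators : iIndepFun (fun j ω => countingProcess fun i => X j i ω) P
  fading_law : ∀ j i k, HasLaw (h j i k) (expMeasure 1) P
  indep_fading : iIndepFun (fun (p : N × ℕ × N) ω => h p.1 p.2.1 p.2.2 ω) P
  indep_fading_location : IndepFun (fun ω (p : N × ℕ × N) => h p.1 p.2.1 p.2.2 ω)
    (fun ω (q : N × ℕ) => X q.1 q.2 ω) P

/-- The path loss `‖x‖ ^ (-α)` between `x` and the reference user at the origin. -/
noncomputable def pathLoss (α : ℝ) (x : Plane) : ℝ := ‖x‖ ^ (-α)

/-- Under full sharing the reference user is served by the closest transmitter of all operators: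
transmitter `s.2` of operator `s.1` is closest to the origin. -/
def IsServing {N : Type*} (x : N → ℕ → Plane) (s : N × ℕ) : Prop :=
  ∀ q : N × ℕ, ‖x s.1 s.2‖ ≤ ‖x q.1 q.2‖

/-- The interference in band `k` when the user is served by transmitter `s`: the total received
power in that band from all other transmitters of all operators. -/
noncomputable def interference {N : Type*} (α : ℝ) (x : N → ℕ → Plane) (h : N → ℕ → N → ℝ)
    (s : N × ℕ) (k : N) : ℝ≥0∞ :=
  ∑' q : {q : N × ℕ // q ≠ s},
    ENNReal.ofReal (h q.1.1 q.1.2 k * pathLoss α (x q.1.1 q.1.2))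

/-- The signal-to-interference-and-noise ratio in band `k` when the user is served by transmitter
`s`, with noise power `η * W`. -/
noncomputable def SINR {N : Type*} (α η W : ℝ) (x : N → ℕ → Plane) (h : N → ℕ → N → ℝ)
    (s : N × ℕ) (k : N) : ℝ≥0∞ :=
  ENNReal.ofReal (h s.1 s.2 k * pathLoss α (x s.1 s.2)) /
    (ENNReal.ofReal (η * W) + interference α x h s k)

/-- The coverage probability in the full sharing scenario: the probability that, at the closest
transmitter, the SINR exceeds the threshold `θ` in at least one of the shared bands. -/
noncomputable def coverageProbability {N Ω : Type*} [MeasurableSpace Ω] (P : Measure Ω)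
    (α η W θ : ℝ) (X : N → ℕ → Ω → Plane) (h : N → ℕ → N → Ω → ℝ) : ℝ :=
  P.real {ω | ∃ s : N × ℕ, IsServing (fun j i => X j i ω) s ∧
    ∃ k : N, ENNReal.ofReal θ < SINR α η W (fun j i => X j i ω) (fun j i l => h j i l ω) s k}

/-! Fix the locations and let `s` be the nearest transmitter. An exponential variable exceeds a
level with probability exp(-level), and E exp(-h w) = 1/(1 + w). Hence one band covers with
conditional probability p = exp(-noise - ∑ log(1 + θ ℓ_q/ℓ_s)), summed over the interferers
(`measure_lt_SINR`). Fadings in different bands are independent, so some band covers with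
probability 1 - (1 - p)^n, an alternating binomial sum of powers p^m (`measure_exists_lt_SINR`,
`IsSharedNetwork.coverageProbability_eq_sum`).

It remains to compute E p^m. In squared distances t_q the path loss ratios depend only on t_s/t_q,
and p^m = exp(-γ(t_s) - ∑ κ(t_s/t_q)) with κ(z) = m log(1 + θ z^(α/2)). The t_q of all operators
together form a Poisson process of constant rate c = π ∑ λ_j on the half-line, because a disc of
radius √b has area πb (`IsSharedNetwork.laplace_norm_sq`).

The density of the nearest point is obtained from the Laplace functional alone, without Palm
calculus. The contribution of nearest points in [u, v) is squeezed between differences of Laplace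
functionals, up to the event of two points in [u, v), whose probability is O((v - u)²)
(`IsHalfLinePoisson.nearestSum_Ico_bounds`). So the contribution of [0, u) has right derivative c
exp(-γ(u) - c u (1 + z)), where u z = ∫ (1 - exp(-κ(u/y))) dy over y > u by scaling, and integrating
gives E p^m (`IsHalfLinePoisson.lintegral_nearestSum`).

Finally z is computed by expanding 1 - (1 + w)^(-m) in powers of w/(1 + w). The substitution y =
t^(-2/α) turns each term into Euler's integral for the hypergeometric function
(`integral_interference_pow`, `lintegral_interferenceExponent`). -/

open Filter Topology

/-! ### Laplace functional of a Poisson process -/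

/-- The function `x ↦ exp (-x)` on `[0, ∞]`, with `exp (-∞) = 0`. -/
noncomputable def negExp (x : ℝ≥0∞) : ℝ≥0∞ := EReal.exp (-(x : EReal))

namespace negExp

@[simp] theorem zero : negExp 0 = 1 := by simp [negExp]

@[simp] theorem top : negExp ∞ = 0 := by simp [negExp]

theorem ofReal {x : ℝ} (hx : 0 ≤ x) :
    negExp (ENNReal.ofReal x) = ENNReal.ofReal (Real.exp (-x)) := by
  rw [negExp, EReal.coe_ennreal_ofReal, max_eq_left hx, ← EReal.coe_neg, EReal.exp_coe]

theorem antitone : Antitone negExp := fun x y h => by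
  refine EReal.exp_monotone (EReal.neg_le_neg_iff.2 ?_)
  exact_mod_cast h

theorem continuous : Continuous negExp :=
  ENNReal.continuous_exp.comp (continuous_neg.comp continuous_coe_ennreal_ereal)

@[fun_prop] theorem measurable : Measurable negExp := antitone.measurable

theorem le_one (x : ℝ≥0∞) : negExp x ≤ 1 := by
  rw [← zero]; exact antitone (zero_le)

theorem ne_top (x : ℝ≥0∞) : negExp x ≠ ∞ := ((le_one x).trans_lt ENNReal.one_lt_top).ne

theorem add (x y : ℝ≥0∞) : negExp (x + y) = negExp x * negExp y := by
  rw [negExp, EReal.coe_ennreal_add, EReal.neg_add (Or.inl (by simp)) (Or.inr (by simp)),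
    sub_eq_add_neg, EReal.exp_add]; rfl

theorem sum {ι : Type*} (s : Finset ι) (f : ι → ℝ≥0∞) :
    negExp (∑ i ∈ s, f i) = ∏ i ∈ s, negExp (f i) := by
  classical
  induction s using Finset.induction_on with
  | empty => simp
  | insert a s ha ih => rw [Finset.sum_insert ha, Finset.prod_insert ha, add, ih]

theorem natCast_mul (n : ℕ) (x : ℝ≥0∞) : negExp (n * x) = negExp x ^ n := by
  induction n with
  | zero => simp
  | succ n ih => rw [Nat.cast_succ, add_mul, one_mul, add, ih, pow_succ]

theorem tendsto_finset_sum {ι : Type*} (f : ι → ℝ≥0∞) :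
    Tendsto (fun s : Finset ι => negExp (∑ i ∈ s, f i)) atTop (𝓝 (negExp (∑' i, f i))) :=
  (continuous.tendsto _).comp ENNReal.summable.hasSum

end negExp

/-- The Laplace transform of a Poisson distribution. -/
theorem lintegral_negExp_poissonMeasure (r : NNReal) (a : ℝ≥0∞) :
    ∫⁻ n : ℕ, negExp (a * n) ∂(poissonMeasure r) = negExp (r * (1 - negExp a)) := by
  have hz0 := negExp.ne_top a
  -- The value `a = ∞` is included: then z = 0 and the identity is the void probability exp(-r).
  set z := (negExp a).toReal with hz
  have hz' : negExp a = ENNReal.ofReal z := (ENNReal.ofReal_toReal hz0).symm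
  have hz1 : 0 ≤ z := ENNReal.toReal_nonneg
  have hz2 : z ≤ 1 := ENNReal.toReal_le_of_le_ofReal zero_le_one (by simpa using negExp.le_one a)
  have h1 : (r : ℝ≥0∞) * (1 - negExp a) = ENNReal.ofReal (r * (1 - z)) := by
    rw [hz', ENNReal.ofReal_mul (NNReal.coe_nonneg r), ENNReal.ofReal_sub _ hz1]; simp
  rw [h1, negExp.ofReal (mul_nonneg (NNReal.coe_nonneg r) (by linarith)), poissonMeasure, lintegral_sum_measure]
  simp only [lintegral_smul_measure, lintegral_dirac, smul_eq_mul]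
  have h2 : HasSum (fun n : ℕ => Real.exp (-r) * r ^ n / (n.factorial) * z ^ n)
      (Real.exp (-(r * (1 - z)))) := by
    have := (NormedSpace.expSeries_div_hasSum_exp ((r : ℝ) * z)).mul_left (Real.exp (-r))
    rw [← Real.exp_eq_exp_ℝ, ← Real.exp_add] at this
    rw [show -(r * (1 - z)) = -r + r * z by ring]
    refine this.congr_fun fun n => ?_
    rw [mul_pow]; ring
  rw [← h2.tsum_eq, ENNReal.ofReal_tsum_of_nonneg (fun n => by positivity) h2.summable]
  refine tsum_congr fun n => ?_
  rw [mul_comm a, negExp.natCast_mul, hz', ← ENNReal.ofReal_pow hz1,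
    ← ENNReal.ofReal_mul (by positivity)]

namespace IsPoissonProcess

variable {Ω : Type*} [MeasurableSpace Ω] {Φ : Ω → Measure Plane} {ν : Measure Plane}
  {P : Measure Ω}

theorem lintegral_negExp_count (hΦ : IsPoissonProcess Φ ν P) (a : ℝ≥0∞) {B : Set Plane}
    (hB : MeasurableSet B) (hν : ν B ≠ ∞) :
    ∫⁻ ω, negExp (a * Φ ω B) ∂P = negExp (ν B * (1 - negExp a)) := by
  have h := (hΦ.hasLaw_count B hB hν).lintegral_comp (f := fun x => negExp (a * x))
    (by fun_prop)
  rw [h, lintegral_map (by fun_prop) (by fun_prop), lintegral_negExp_poissonMeasure,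
    ENNReal.coe_toNNReal hν]

/-- The fibres of the nonzero values are disjoint sets with independent Poisson counts, so the
expectation factorises into Laplace transforms of Poisson variables. -/
theorem laplace_simpleFunc (hΦ : IsPoissonProcess Φ ν P) (f : SimpleFunc Plane ℝ≥0∞)
    (hf : f.FinMeasSupp ν) :
    ∫⁻ ω, negExp (∫⁻ x, f x ∂(Φ ω)) ∂P = negExp (∫⁻ x, (1 - negExp (f x)) ∂ν) := by
  classical
  -- The value 0 is left out because its fibre may have infinite intensity; it contributes nothing
  -- on either side.
  set S := f.range.filter (· ≠ 0) with hS
  have h1 : ∀ (g : ℝ≥0∞ → ℝ≥0∞), g 0 = 0 → ∀ μ : Measure Plane,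
      ∫⁻ x, g (f x) ∂μ = ∑ i : Fin S.card, g (S.equivFin.symm i) *
        μ (f ⁻¹' {(S.equivFin.symm i : ℝ≥0∞)}) := by
    intro g hg μ
    have : ∫⁻ x, g (f x) ∂μ = (f.map g).lintegral μ := by
      rw [← SimpleFunc.lintegral_eq_lintegral]; rfl
    rw [this, SimpleFunc.map_lintegral,
      Equiv.sum_comp S.equivFin.symm (fun a : S => g a * μ (f ⁻¹' {(a : ℝ≥0∞)})),
      Finset.sum_coe_sort S (fun a => g a * μ (f ⁻¹' {a})), hS, Finset.sum_filter]
    refine Finset.sum_congr rfl fun a _ => ?_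
    split_ifs with h
    · rfl
    · rw [not_not.1 h, hg, zero_mul]
  have hfin : ∀ i : Fin S.card, ν (f ⁻¹' {(S.equivFin.symm i : ℝ≥0∞)}) ≠ ∞ := by
    intro i
    have h0 : (S.equivFin.symm i : ℝ≥0∞) ≠ 0 := (Finset.mem_filter.1 (S.equivFin.symm i).2).2
    exact (SimpleFunc.finMeasSupp_iff.1 hf _ h0).ne
  have hind := hΦ.indep_count S.card (fun i => f ⁻¹' {(S.equivFin.symm i : ℝ≥0∞)})
    (fun i => f.measurableSet_fiber _) (by
      intro i j hij
      refine Disjoint.preimage _ (Set.disjoint_singleton.2 fun h => hij ?_)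
      exact S.equivFin.symm.injective (Subtype.ext h))
  have h2 := h1 (fun a => a) rfl
  simp only [h2, h1 (fun a => 1 - negExp a) (by simp), negExp.sum]
  refine (lintegral_prod_eq_prod_lintegral_of_indepFun Finset.univ _
    (hind.comp (fun i x => negExp ((S.equivFin.symm i : ℝ≥0∞) * x)) (fun i => by fun_prop))
    (fun i => by
      have := (Measure.measurable_coe (f.measurableSet_fiber
        (S.equivFin.symm i : ℝ≥0∞))).comp hΦ.measurable
      simp only [Function.comp_def] at this ⊢
      fun_prop)).trans ?_
  refine Finset.prod_congr rfl fun i _ => ?_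
  rw [mul_comm (1 - _)]
  exact hΦ.lintegral_negExp_count _ (f.measurableSet_fiber _) (hfin i)

/-- The Laplace functional of a Poisson point process. -/
theorem laplace [IsProbabilityMeasure P] [SigmaFinite ν] (hΦ : IsPoissonProcess Φ ν P)
    {ψ : Plane → ℝ≥0∞} (hψ : Measurable ψ) :
    ∫⁻ ω, negExp (∫⁻ x, ψ x ∂(Φ ω)) ∂P = negExp (∫⁻ x, (1 - negExp (ψ x)) ∂ν) := by
  -- Cutting off outside the n-th spanning set keeps the approximation increasing and gives it a
  -- support of finite measure.
  set f : ℕ → SimpleFunc Plane ℝ≥0∞ := fun n =>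
    (SimpleFunc.eapprox ψ n).restrict (spanningSets ν n) with hf
  have hfx : ∀ n x, f n x = (spanningSets ν n).indicator (SimpleFunc.eapprox ψ n) x := fun n x =>
    SimpleFunc.restrict_apply _ (measurableSet_spanningSets ν n) x
  have hmono : ∀ x, Monotone fun n => f n x := by
    intro x m n hmn
    simp only [hfx]
    by_cases hx : x ∈ spanningSets ν m
    · rw [Set.indicator_of_mem hx, Set.indicator_of_mem (monotone_spanningSets ν hmn hx)]
      exact SimpleFunc.monotone_eapprox ψ hmn x
    · rw [Set.indicator_of_notMem hx]; exact zero_le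
  have hlim : ∀ x, Tendsto (fun n => f n x) atTop (𝓝 (ψ x)) := by
    intro x
    refine (SimpleFunc.tendsto_eapprox hψ x).congr' ?_
    filter_upwards [eventually_ge_atTop (spanningSetsIndex ν x)] with n hn
    rw [hfx, Set.indicator_of_mem (monotone_spanningSets ν hn (mem_spanningSetsIndex ν x))]
  have hfin : ∀ n, (f n).FinMeasSupp ν := by
    intro n
    rw [SimpleFunc.finMeasSupp_iff_support]
    refine (measure_mono ?_).trans_lt (measure_spanningSets_lt_top ν n)
    intro x hx
    by_contra h
    exact hx (by rw [hfx, Set.indicator_of_notMem h])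
  have hL : Tendsto (fun n => ∫⁻ ω, negExp (∫⁻ x, f n x ∂(Φ ω)) ∂P) atTop
      (𝓝 (∫⁻ ω, negExp (∫⁻ x, ψ x ∂(Φ ω)) ∂P)) := by
    refine tendsto_lintegral_of_dominated_convergence (fun _ => 1) (fun n => ?_)
      (fun n => Eventually.of_forall fun ω => negExp.le_one _) (by simp)
      (Eventually.of_forall fun ω => ?_)
    · exact negExp.measurable.comp
        ((Measure.measurable_lintegral (f n).measurable).comp hΦ.measurable)
    · exact (negExp.continuous.tendsto _).comp (lintegral_tendsto_of_tendsto_of_monotone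
        (fun n => (f n).measurable.aemeasurable) (Eventually.of_forall hmono)
        (Eventually.of_forall hlim))
  have hR : Tendsto (fun n => negExp (∫⁻ x, (1 - negExp (f n x)) ∂ν)) atTop
      (𝓝 (negExp (∫⁻ x, (1 - negExp (ψ x)) ∂ν))) := by
    refine (negExp.continuous.tendsto _).comp (lintegral_tendsto_of_tendsto_of_monotone
      (fun n => (measurable_const.sub (negExp.measurable.comp (f n).measurable)).aemeasurable)
      (Eventually.of_forall fun x m n hmn => tsub_le_tsub_left (negExp.antitone (hmono x hmn)) _)
      (Eventually.of_forall fun x => ?_))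
    exact ENNReal.Tendsto.sub tendsto_const_nhds ((negExp.continuous.tendsto _).comp (hlim x))
      (Or.inl ENNReal.one_ne_top)
  simp only [fun n => hΦ.laplace_simpleFunc (f n) (hfin n)] at hL
  exact tendsto_nhds_unique hL hR

end IsPoissonProcess

/-! ### From the plane to squared distances on the half-line -/

/-- The preimage of (-∞, b) is the disc of radius √b, of area πb. Both measures are thus equal and
finite on these rays, hence equal on half-open intervals, which determine them. -/
theorem map_norm_sq_volume :
    (volume : Measure Plane).map (fun x => ‖x‖ ^ 2) =
      ENNReal.ofReal Real.pi • volume.restrict (Set.Ioi (0 : ℝ)) := by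
  have hm : Measurable fun x : Plane => ‖x‖ ^ 2 := by fun_prop
  have h1 : ∀ b : ℝ, (volume : Measure Plane).map (fun x => ‖x‖ ^ 2) (Set.Iio b) =
      ENNReal.ofReal Real.pi * ENNReal.ofReal b := by
    intro b
    have : (fun x : Plane => ‖x‖ ^ 2) ⁻¹' Set.Iio b = Metric.ball 0 (√b) := by
      ext x
      simp [Real.lt_sqrt]
    rw [Measure.map_apply hm measurableSet_Iio, this, EuclideanSpace.volume_ball_fin_two,
      mul_comm, ← ENNReal.ofReal_pow (Real.sqrt_nonneg b)]
    congr 1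
    rcases le_total 0 b with hb | hb
    · rw [Real.sq_sqrt hb]
    · rw [Real.sqrt_eq_zero_of_nonpos hb, ENNReal.ofReal_of_nonpos hb]; simp
  have h2 : ∀ b : ℝ, (ENNReal.ofReal Real.pi • volume.restrict (Set.Ioi (0 : ℝ))) (Set.Iio b) =
      ENNReal.ofReal Real.pi * ENNReal.ofReal b := by
    intro b
    rw [Measure.smul_apply, Measure.restrict_apply measurableSet_Iio, Set.inter_comm,
      Set.Ioi_inter_Iio, Real.volume_Ioo, sub_zero, smul_eq_mul]
  have hfin : ∀ b : ℝ, ENNReal.ofReal Real.pi * ENNReal.ofReal b ≠ ∞ := fun b =>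
    ENNReal.mul_ne_top ENNReal.ofReal_ne_top ENNReal.ofReal_ne_top
  have h3 : ∀ μ : Measure ℝ, (∀ b, μ (Set.Iio b) = ENNReal.ofReal Real.pi * ENNReal.ofReal b) →
      ∀ a b : ℝ, a < b → μ (Set.Ico a b) =
        ENNReal.ofReal Real.pi * ENNReal.ofReal b - ENNReal.ofReal Real.pi * ENNReal.ofReal a := by
    intro μ hμ a b hab
    have : Set.Ico a b = Set.Iio b \ Set.Iio a := by ext; simp
    rw [this, measure_sdiff (Set.Iio_subset_Iio hab.le) measurableSet_Iio.nullMeasurableSet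
      (by rw [hμ]; exact hfin a), hμ, hμ]
  refine Measure.ext_of_Ico' _ _ (fun a b hab => ?_) fun a b hab => ?_
  · rw [h3 _ h1 a b hab]
    exact (tsub_le_self.trans_lt (hfin b).lt_top).ne
  · rw [h3 _ h1 a b hab, h3 _ h2 a b hab]

theorem lintegral_comp_norm_sq {f : ℝ → ℝ≥0∞} (hf : Measurable f) :
    ∫⁻ x : Plane, f (‖x‖ ^ 2) = ENNReal.ofReal Real.pi * ∫⁻ u in Set.Ioi (0 : ℝ), f u := by
  rw [← lintegral_map hf (g := fun x : Plane => ‖x‖ ^ 2) (by fun_prop), map_norm_sq_volume,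
    lintegral_smul_measure, smul_eq_mul]

theorem lintegral_countingProcess (x : ℕ → Plane) {ψ : Plane → ℝ≥0∞} (hψ : Measurable ψ) :
    ∫⁻ y, ψ y ∂(countingProcess x) = ∑' i, ψ (x i) := by
  rw [countingProcess, lintegral_sum_measure]
  simp only [lintegral_dirac' _ hψ]

/-- The squared distances to the origin of all transmitters of a shared network form a homogeneous
Poisson process on the half-line. -/
theorem IsSharedNetwork.laplace_norm_sq {N Ω : Type*} [Fintype N] [MeasurableSpace Ω]
    {P : Measure Ω} [IsProbabilityMeasure P] {lam : N → ℝ} {X : N → ℕ → Ω → Plane}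
    {h : N → ℕ → N → Ω → ℝ} (hnet : IsSharedNetwork P lam X h) (hlam : ∀ j, 0 < lam j)
    {ρ : ℝ → ℝ≥0∞} (hρ : Measurable ρ) :
    ∫⁻ ω, negExp (∑' q : N × ℕ, ρ (‖X q.1 q.2 ω‖ ^ 2)) ∂P =
      negExp (ENNReal.ofReal (Real.pi * ∑ j, lam j) *
        ∫⁻ u in Set.Ioi (0 : ℝ), (1 - negExp (ρ u))) := by
  have hψ : Measurable fun x : Plane => ρ (‖x‖ ^ 2) := by fun_prop
  have h1 : ∀ ω, negExp (∑' q : N × ℕ, ρ (‖X q.1 q.2 ω‖ ^ 2)) =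
      ∏ j, negExp (∫⁻ y, ρ (‖y‖ ^ 2) ∂(countingProcess fun i => X j i ω)) := by
    intro ω
    rw [ENNReal.tsum_prod (f := fun j i => ρ (‖X j i ω‖ ^ 2)), tsum_fintype, negExp.sum]
    refine Finset.prod_congr rfl fun j _ => ?_
    rw [lintegral_countingProcess _ hψ]
  have hm : Measurable fun μ : Measure Plane => negExp (∫⁻ y, ρ (‖y‖ ^ 2) ∂μ) :=
    negExp.measurable.comp (Measure.measurable_lintegral hψ)
  simp only [h1]
  refine (lintegral_prod_eq_prod_lintegral_of_indepFun Finset.univ _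
    (hnet.indep_operators.comp (fun _ μ => negExp (∫⁻ y, ρ (‖y‖ ^ 2) ∂μ)) fun _ => hm)
    (fun j => hm.comp (hnet.poisson j).measurable)).trans ?_
  have h2 : ∀ j, ∫⁻ ω, negExp (∫⁻ y, ρ (‖y‖ ^ 2) ∂(countingProcess fun i => X j i ω)) ∂P =
      negExp (ENNReal.ofReal (Real.pi * lam j) *
        ∫⁻ u in Set.Ioi (0 : ℝ), (1 - negExp (ρ u))) := by
    intro j
    have : SigmaFinite (ENNReal.ofReal (lam j) • (volume : Measure Plane)) :=
      inferInstanceAs (SigmaFinite ((lam j).toNNReal • (volume : Measure Plane)))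
    rw [(hnet.poisson j).laplace hψ, lintegral_smul_measure,
      lintegral_comp_norm_sq (f := fun u => 1 - negExp (ρ u)) (by fun_prop), smul_eq_mul,
      ← mul_assoc, ← ENNReal.ofReal_mul (hlam j).le, mul_comm (lam j)]
  refine (Finset.prod_congr rfl fun j _ => h2 j).trans ?_
  rw [← negExp.sum, ← Finset.sum_mul, ← ENNReal.ofReal_sum_of_nonneg
    (fun j _ => mul_nonneg Real.pi_pos.le (hlam j).le), Finset.mul_sum]

/-! ### Pathwise bounds for functionals of the nearest point -/

section Nearest

variable {I : Type*}

/-- The point with index `s` is strictly smaller than all other points. -/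
def IsNearest (x : I → ℝ) (s : I) : Prop := ∀ q, q ≠ s → x s < x q

/-- If the smallest point `x s` exists, is unique and lies in `A`, the value at this point of
`exp (-γ (x s) - ∑ κ (x s / x q))` with the sum over all other points; otherwise `0`. -/
noncomputable def nearestSum (γ : ℝ → ℝ) (κ : ℝ → ℝ≥0∞) (A : Set ℝ) (x : I → ℝ) : ℝ≥0∞ :=
  ∑' s, {x : I → ℝ | IsNearest x s ∧ x s ∈ A}.indicator
    (fun x => negExp (ENNReal.ofReal (γ (x s)) + ∑' q : {q // q ≠ s}, κ (x s / x q))) x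

theorem IsNearest.unique {x : I → ℝ} {s s' : I} (h : IsNearest x s) (h' : IsNearest x s') :
    s = s' := by
  by_contra hne
  exact lt_asymm (h s' (Ne.symm hne)) (h' s hne)

theorem measurableSet_isNearest [Countable I] (s : I) :
    MeasurableSet {x : I → ℝ | IsNearest x s} := by
  have : {x : I → ℝ | IsNearest x s} = ⋂ q, ⋂ (_ : q ≠ s), {x | x s < x q} := by
    ext x; simp [IsNearest]
  rw [this]
  exact MeasurableSet.iInter fun q => MeasurableSet.iInter fun _ =>
    measurableSet_lt (measurable_pi_apply s) (measurable_pi_apply q)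

theorem measurable_nearestSum [Countable I] {γ : ℝ → ℝ} {κ : ℝ → ℝ≥0∞} {A : Set ℝ}
    (hγ : Measurable γ) (hκ : Measurable κ) (hA : MeasurableSet A) :
    Measurable (nearestSum (I := I) γ κ A) := by
  refine Measurable.tsum fun s => Measurable.indicator ?_
    ((measurableSet_isNearest s).inter (measurable_pi_apply s hA))
  have : Measurable fun x : I → ℝ => ∑' q : {q // q ≠ s}, κ (x s / x q) :=
    Measurable.tsum fun q => by fun_prop
  fun_prop

theorem nearestSum_of_isNearest {x : I → ℝ} {s : I} (h : IsNearest x s) (γ : ℝ → ℝ)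
    (κ : ℝ → ℝ≥0∞) {A : Set ℝ} (hA : x s ∈ A) :
    nearestSum γ κ A x =
      negExp (ENNReal.ofReal (γ (x s)) + ∑' q : {q // q ≠ s}, κ (x s / x q)) := by
  rw [nearestSum, tsum_eq_single s, Set.indicator_of_mem]
  · exact ⟨h, hA⟩
  · intro s' hs'
    exact Set.indicator_of_notMem (fun h' => hs' (h'.1.unique h)) _

theorem nearestSum_eq_zero {x : I → ℝ} (γ : ℝ → ℝ) (κ : ℝ → ℝ≥0∞) {A : Set ℝ}
    (h : ∀ s, IsNearest x s → x s ∉ A) : nearestSum γ κ A x = 0 := by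
  rw [nearestSum, ENNReal.tsum_eq_zero]
  exact fun s => Set.indicator_of_notMem (fun h' => h s h'.1 h'.2) _

theorem nearestSum_le_one (γ : ℝ → ℝ) (κ : ℝ → ℝ≥0∞) (A : Set ℝ) (x : I → ℝ) :
    nearestSum γ κ A x ≤ 1 := by
  by_cases h : ∃ s, IsNearest x s ∧ x s ∈ A
  · obtain ⟨s, hs, hA⟩ := h
    rw [nearestSum_of_isNearest hs γ κ hA]
    exact negExp.le_one _
  · push Not at h
    rw [nearestSum_eq_zero γ κ h]
    exact zero_le_one

theorem nearestSum_union {A B : Set ℝ} (hAB : Disjoint A B) (γ : ℝ → ℝ) (κ : ℝ → ℝ≥0∞)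
    (x : I → ℝ) : nearestSum γ κ (A ∪ B) x = nearestSum γ κ A x + nearestSum γ κ B x := by
  rw [nearestSum, nearestSum, nearestSum, ← ENNReal.tsum_add]
  refine tsum_congr fun s => ?_
  classical
  have h : x s ∈ A → x s ∉ B := fun h => Set.disjoint_left.1 hAB h
  by_cases hs : IsNearest x s <;> by_cases hA : x s ∈ A <;> by_cases hB : x s ∈ B <;>
    simp_all

/-- In the weights, `∞` forbids points and 0 ignores them. The two products therefore differ exactly
on the event that there is no point below u but one in [u, v), and there the right-hand product is
an upper bound: by monotonicity, moving the nearest point down to u and ignoring the other points of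
[u, v) only lowers the exponent. Both products are accessible through the Laplace functional. -/
theorem nearestSum_add_le {x : I → ℝ} (hx : ∀ q, 0 ≤ x q) {γ : ℝ → ℝ} {κ : ℝ → ℝ≥0∞}
    (hγ : MonotoneOn γ (Set.Ici 0)) (hκ : MonotoneOn κ (Set.Ici 0)) {u v : ℝ} (hu : 0 ≤ u)
    (huv : u ≤ v) :
    nearestSum γ κ (Set.Ico u v) x + negExp (ENNReal.ofReal (γ u)) *
        negExp (∑' q, if x q < v then ∞ else κ (u / x q)) ≤
      negExp (ENNReal.ofReal (γ u)) *
        negExp (∑' q, if x q < u then ∞ else if x q < v then 0 else κ (u / x q)) := by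
  by_cases h0 : ∃ q, x q < u
  · obtain ⟨q, hq⟩ := h0
    have h1 : (∑' q, if x q < v then ∞ else κ (u / x q)) = ∞ :=
      ENNReal.tsum_eq_top_of_eq_top ⟨q, if_pos (hq.trans_le huv)⟩
    rw [h1, negExp.top, mul_zero, add_zero, nearestSum_eq_zero]
    · exact zero_le
    · intro s hs hsA
      rcases eq_or_ne q s with rfl | hne
      · exact not_le.2 hq hsA.1
      · exact not_le.2 ((hs q hne).trans hq) hsA.1
  push Not at h0
  simp only [if_neg (not_lt.2 (h0 _))]
  by_cases h1 : ∃ q, x q < v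
  · obtain ⟨q, hq⟩ := h1
    have h1 : (∑' q, if x q < v then ∞ else κ (u / x q)) = ∞ :=
      ENNReal.tsum_eq_top_of_eq_top ⟨q, if_pos hq⟩
    rw [h1, negExp.top, mul_zero, add_zero, ← negExp.add]
    by_cases hs : ∃ s, IsNearest x s ∧ x s ∈ Set.Ico u v
    · obtain ⟨s, hs, hsA⟩ := hs
      rw [nearestSum_of_isNearest hs γ κ hsA]
      refine negExp.antitone (add_le_add
        (ENNReal.ofReal_le_ofReal (hγ hu (hu.trans hsA.1) hsA.1)) ?_)
      -- The nearest point has weight 0 here, so the sum over all points is a sum over the others.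
      have hsupp : Function.support (fun q => if x q < v then 0 else κ (u / x q)) ⊆
          {q | q ≠ s} := by
        intro q hq hqs
        exact hq (by simp [show q = s from hqs, hsA.2])
      rw [← tsum_subtype_eq_of_support_subset hsupp]
      refine ENNReal.tsum_le_tsum fun q => ?_
      split_ifs
      · exact zero_le
      · exact hκ (div_nonneg hu (hx _)) (div_nonneg (hx _) (hx _))
          (div_le_div_of_nonneg_right hsA.1 (hx _))
    · push Not at hs
      rw [nearestSum_eq_zero γ κ hs]
      exact zero_le
  · push Not at h1
    simp only [if_neg (not_lt.2 (h1 _))]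
    rw [nearestSum_eq_zero, zero_add]
    exact fun s _ hsA => not_lt.2 (h1 s) hsA.2

open Classical in
-- The counterpart of `nearestSum_add_le` with the nearest point moved up to v. Ignoring points in
-- [u, v) is harmless only if the nearest point is the only one there; otherwise there may be ties
-- or uncounted terms κ, and the indicator of two points absorbs the error.
theorem le_nearestSum_add {x : I → ℝ} (hx : ∀ q, 0 ≤ x q) {γ : ℝ → ℝ} {κ : ℝ → ℝ≥0∞}
    (hγ : MonotoneOn γ (Set.Ici 0)) (hκ : MonotoneOn κ (Set.Ici 0)) {u v : ℝ} (hu : 0 ≤ u)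
    (huv : u ≤ v) :
    negExp (ENNReal.ofReal (γ v)) *
        negExp (∑' q, if x q < u then ∞ else if x q < v then 0 else κ (v / x q)) ≤
      nearestSum γ κ (Set.Ico u v) x +
        (if ∃ p q, p ≠ q ∧ x p ∈ Set.Ico u v ∧ x q ∈ Set.Ico u v then 1 else 0) +
        negExp (ENNReal.ofReal (γ v)) *
          negExp (∑' q, if x q < v then ∞ else κ (v / x q)) := by
  by_cases h0 : ∃ q, x q < u
  · obtain ⟨q, hq⟩ := h0
    have h1 : (∑' q, if x q < u then ∞ else if x q < v then 0 else κ (v / x q)) = ∞ :=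
      ENNReal.tsum_eq_top_of_eq_top ⟨q, if_pos hq⟩
    rw [h1, negExp.top, mul_zero]
    exact zero_le
  push Not at h0
  simp only [if_neg (not_lt.2 (h0 _))]
  by_cases h1 : ∃ s, x s < v
  · obtain ⟨s, hsv⟩ := h1
    by_cases h2 : ∃ p q, p ≠ q ∧ x p ∈ Set.Ico u v ∧ x q ∈ Set.Ico u v
    · rw [if_pos h2, ← negExp.add]
      exact (negExp.le_one _).trans (le_add_right (le_add_left le_rfl))
    · push Not at h2
      have hq : ∀ q, q ≠ s → v ≤ x q := fun q hq => by
        by_contra hqv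
        exact h2 s q hq.symm ⟨h0 s, hsv⟩ ⟨h0 q, not_le.1 hqv⟩
      have hs : IsNearest x s := fun q hqs => hsv.trans_le (hq q hqs)
      refine le_add_right (le_add_right ?_)
      rw [nearestSum_of_isNearest hs γ κ (A := Set.Ico u v) ⟨h0 s, hsv⟩, ← negExp.add]
      refine negExp.antitone (add_le_add
        (ENNReal.ofReal_le_ofReal (hγ (hu.trans (h0 s)) (hu.trans huv) hsv.le)) ?_)
      have hsupp : Function.support (fun q => if x q < v then 0 else κ (v / x q)) ⊆
          {q | q ≠ s} := by
        intro q hq hqs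
        exact hq (by simp [show q = s from hqs, hsv])
      rw [← tsum_subtype_eq_of_support_subset hsupp]
      refine ENNReal.tsum_le_tsum fun q => ?_
      rw [if_neg (not_lt.2 (hq q q.2))]
      exact hκ (div_nonneg (hx _) (hx _)) (div_nonneg (hu.trans huv) (hx _))
          (div_le_div_of_nonneg_right hsv.le (hx _))
  · push Not at h1
    simp only [if_neg (not_lt.2 (h1 _))]
    exact le_add_left le_rfl

theorem negExp_ofReal_log_two : negExp (ENNReal.ofReal (Real.log 2)) = ENNReal.ofReal (1 / 2) := by
  rw [negExp.ofReal (Real.log_nonneg one_le_two), Real.exp_neg, Real.exp_log two_pos, one_div]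

open Classical in
/-- The number of points in `[u, v)` enters through `2` to the power of its negative. -/
theorem two_points_add_le (x : I → ℝ) (u v : ℝ) :
    (if ∃ p q, p ≠ q ∧ x p ∈ Set.Ico u v ∧ x q ∈ Set.Ico u v then 1 else 0) +
        4 * negExp (∑' q, if x q ∈ Set.Ico u v then ENNReal.ofReal (Real.log 2) else 0) ≤
      2 + 2 * negExp (∑' q, if x q ∈ Set.Ico u v then ∞ else 0) := by
  -- With n points in [u, v) the claim is 1{n ≥ 2} + 4 · 2^(-n) ≤ 2 + 2 · 1{n = 0}, with equality
  -- for n = 0, 1, 2.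
  set f : I → ℝ≥0∞ := fun q => if x q ∈ Set.Ico u v then ENNReal.ofReal (Real.log 2) else 0
  have hhalf : (ENNReal.ofReal (1 / 2)) = 2⁻¹ := by
    rw [one_div, ENNReal.ofReal_inv_of_pos two_pos]; simp
  have h2 : (4 : ℝ≥0∞) * 2⁻¹ = 2 := by
    rw [show (4 : ℝ≥0∞) = 2 * 2 by norm_num, mul_assoc,
      ENNReal.mul_inv_cancel two_ne_zero (by simp), mul_one]
  split_ifs with h
  · obtain ⟨p, q, hpq, hp, hq⟩ := h
    have : ENNReal.ofReal (Real.log 2) + ENNReal.ofReal (Real.log 2) ≤ ∑' q, f q := by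
      refine le_trans (le_of_eq ?_) (ENNReal.sum_le_tsum {p, q})
      rw [Finset.sum_pair hpq]
      simp only [f, if_pos hp, if_pos hq]
    refine le_add_right ?_
    calc 1 + 4 * negExp (∑' q, f q)
        ≤ 1 + 4 * negExp (ENNReal.ofReal (Real.log 2) + ENNReal.ofReal (Real.log 2)) := by
          gcongr; exact negExp.antitone this
      _ = 2 := by
          rw [negExp.add, negExp_ofReal_log_two, hhalf, ← mul_assoc, h2,
            ENNReal.mul_inv_cancel two_ne_zero (by simp)]
          norm_num
  · by_cases h1 : ∃ p, x p ∈ Set.Ico u v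
    · obtain ⟨p, hp⟩ := h1
      rw [zero_add]
      refine le_add_right ?_
      calc 4 * negExp (∑' q, f q) ≤ 4 * negExp (f p) := by
            gcongr; exact negExp.antitone (ENNReal.le_tsum p)
        _ = 2 := by
          simp only [f, if_pos hp]
          rw [negExp_ofReal_log_two, hhalf, h2]
    · push Not at h1
      simp only [f, if_neg (h1 _), tsum_zero, negExp.zero]
      norm_num

end Nearest

/-! ### Poisson processes on the half-line through their Laplace functional -/

/-- Scaling of the exponent of the interference beyond distance `u`. -/
theorem lintegral_Ioi_scale {κ : ℝ → ℝ≥0∞} (hκm : Measurable κ) (hκ0 : κ 0 = 0) {u : ℝ}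
    (hu : 0 ≤ u) :
    ∫⁻ y in Set.Ioi u, (1 - negExp (κ (u / y))) =
      ENNReal.ofReal u * ∫⁻ y in Set.Ioi (1 : ℝ), (1 - negExp (κ (1 / y))) := by
  rcases hu.eq_or_lt with rfl | hu
  · simp [hκ0]
  rw [← lintegral_indicator measurableSet_Ioi, ← lintegral_indicator measurableSet_Ioi,
    ← Real.smul_map_volume_mul_left hu.ne', lintegral_smul_measure, lintegral_map
      (Measurable.indicator (by fun_prop) measurableSet_Ioi) (by fun_prop),
    Real.smul_map_volume_mul_left hu.ne', abs_of_pos hu, smul_eq_mul]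
  congr 1
  refine lintegral_congr fun y => ?_
  by_cases hy : 1 < y
  · rw [Set.indicator_of_mem (by simpa [hu] using hy), Set.indicator_of_mem (by simpa using hy)]
    congr 3
    field_simp
  · rw [Set.indicator_of_notMem (by simpa [hu] using hy),
      Set.indicator_of_notMem (by simpa using hy)]

/-- The points `t q` form a homogeneous Poisson process of intensity `c` on the half-line, in terms of
its Laplace functional. -/
structure IsHalfLinePoisson {I Ω : Type*} [MeasurableSpace Ω] (P : Measure Ω) (t : I → Ω → ℝ)
    (c : ℝ) : Prop where
  pos : 0 < c
  measurable : ∀ q, Measurable (t q)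
  nonneg : ∀ q ω, 0 ≤ t q ω
  laplace : ∀ ρ : ℝ → ℝ≥0∞, Measurable ρ → ∫⁻ ω, negExp (∑' q, ρ (t q ω)) ∂P =
    negExp (ENNReal.ofReal c * ∫⁻ u in Set.Ioi (0 : ℝ), (1 - negExp (ρ u)))

namespace IsHalfLinePoisson

variable {I Ω : Type*} [MeasurableSpace Ω] {P : Measure Ω} {t : I → Ω → ℝ} {c : ℝ}

theorem measurable_pi (h : IsHalfLinePoisson P t c) : Measurable fun ω q => t q ω :=
  measurable_pi_lambda _ h.measurable

/-- The weight `∞` on [0, u) has 1 - exp(-∞) = 1 and contributes the length u to the exponent; the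
weight 0 on [u, v) contributes nothing. -/
theorem laplace_void_void (h : IsHalfLinePoisson P t c) {κ : ℝ → ℝ≥0∞} (hκ : Measurable κ)
    {u v : ℝ} (hu : 0 ≤ u) (huv : u ≤ v) :
    ∫⁻ ω, negExp (∑' q, if t q ω < u then ∞ else if t q ω < v then 0 else κ (t q ω)) ∂P =
      negExp (ENNReal.ofReal c *
        (ENNReal.ofReal u + ∫⁻ y in Set.Ioi v, (1 - negExp (κ y)))) := by
  have hm : Measurable fun y : ℝ => if y < u then ∞ else if y < v then 0 else κ y :=
    Measurable.ite measurableSet_Iio measurable_const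
      (Measurable.ite measurableSet_Iio measurable_const hκ)
  refine (h.laplace _ hm).trans ?_
  congr 2
  have h1 : Set.Ioi (0 : ℝ) = Set.Ioc 0 v ∪ Set.Ioi v :=
    (Set.Ioc_union_Ioi_eq_Ioi (hu.trans huv)).symm
  have h2 : Set.Ioc 0 v = Set.Ioc 0 u ∪ Set.Ioc u v := (Set.Ioc_union_Ioc_eq_Ioc hu huv).symm
  rw [h1, lintegral_union measurableSet_Ioi
    (Set.disjoint_left.2 fun y hy hy' => not_lt.2 hy.2 hy'), h2,
    lintegral_union measurableSet_Ioc
    (Set.disjoint_left.2 fun y hy hy' => not_lt.2 hy.2 hy'.1)]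
  have e1 : ∫⁻ y in Set.Ioc 0 u,
      (1 - negExp (if y < u then ∞ else if y < v then 0 else κ y)) = ENNReal.ofReal u := by
    rw [← setLIntegral_congr Ioo_ae_eq_Ioc, setLIntegral_congr_fun (g := fun _ => 1)
      measurableSet_Ioo fun y hy => by simp [hy.2]]
    simp
  have e2 : ∫⁻ y in Set.Ioc u v,
      (1 - negExp (if y < u then ∞ else if y < v then 0 else κ y)) = 0 := by
    rw [← setLIntegral_congr Ioo_ae_eq_Ioc, setLIntegral_congr_fun (g := fun _ => 0)
      measurableSet_Ioo fun y hy => by simp [hy.2, not_lt.2 hy.1.le]]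
    simp
  have e3 : ∫⁻ y in Set.Ioi v,
      (1 - negExp (if y < u then ∞ else if y < v then 0 else κ y)) =
      ∫⁻ y in Set.Ioi v, (1 - negExp (κ y)) :=
    setLIntegral_congr_fun measurableSet_Ioi fun y hy => by
      have hy : v < y := hy
      simp [not_lt.2 hy.le, not_lt.2 (huv.trans hy.le)]
  rw [e1, e2, e3, add_zero]

theorem laplace_void (h : IsHalfLinePoisson P t c) {κ : ℝ → ℝ≥0∞} (hκ : Measurable κ)
    {v : ℝ} (hv : 0 ≤ v) :
    ∫⁻ ω, negExp (∑' q, if t q ω < v then ∞ else κ (t q ω)) ∂P =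
      negExp (ENNReal.ofReal c *
        (ENNReal.ofReal v + ∫⁻ y in Set.Ioi v, (1 - negExp (κ y)))) := by
  have := h.laplace_void_void hκ hv le_rfl
  rw [← this]
  refine lintegral_congr fun ω => ?_
  congr 1
  refine tsum_congr fun q => ?_
  split_ifs <;> rfl

theorem laplace_Ico (h : IsHalfLinePoisson P t c) (a : ℝ≥0∞) {u v : ℝ} (hu : 0 ≤ u) :
    ∫⁻ ω, negExp (∑' q, if t q ω ∈ Set.Ico u v then a else 0) ∂P =
      negExp (ENNReal.ofReal c * (ENNReal.ofReal (v - u) * (1 - negExp a))) := by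
  have hm : Measurable fun y : ℝ => if y ∈ Set.Ico u v then a else 0 :=
    Measurable.ite measurableSet_Ico measurable_const measurable_const
  refine (h.laplace _ hm).trans ?_
  congr 2
  have : ∀ y, 1 - negExp (if y ∈ Set.Ico u v then a else 0) =
      (Set.Ico u v).indicator (fun _ => 1 - negExp a) y := by
    intro y
    by_cases hy : y ∈ Set.Ico u v
    · rw [if_pos hy, Set.indicator_of_mem hy]
    · rw [if_neg hy, Set.indicator_of_notMem hy]; simp
  simp only [this]
  rw [lintegral_indicator_const measurableSet_Ico, Measure.restrict_apply measurableSet_Ico,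
    mul_comm]
  congr 1
  have h2 : volume (Set.Ico u v) = ENNReal.ofReal (v - u) := Real.volume_Ico
  refine le_antisymm (h2 ▸ measure_mono Set.inter_subset_left) ?_
  rw [← Real.volume_Ioo]
  exact measure_mono fun y hy => ⟨⟨hy.1.le, hy.2⟩, hu.trans_lt hy.1⟩

open Classical in
-- Put y = c(v - u). Integrating `two_points_add_le` bounds the probability by 2 + 2exp(-y) -
-- 4exp(-y/2) = 2(1 - exp(-y/2))², which is at most y²/2. Being of second order in v - u, it does
-- not affect the derivative.
theorem lintegral_two_points_le [Countable I] [IsProbabilityMeasure P]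
    (h : IsHalfLinePoisson P t c) {u v : ℝ} (hu : 0 ≤ u) (huv : u ≤ v) :
    ∫⁻ ω, (if ∃ p q, p ≠ q ∧ t p ω ∈ Set.Ico u v ∧ t q ω ∈ Set.Ico u v then 1 else 0) ∂P ≤
      ENNReal.ofReal ((c * (v - u)) ^ 2 / 2) := by
  set T := ∫⁻ ω,
    (if ∃ p q, p ≠ q ∧ t p ω ∈ Set.Ico u v ∧ t q ω ∈ Set.Ico u v then 1 else 0 : ℝ≥0∞) ∂P
  set y := c * (v - u) with hy
  have hy0 : 0 ≤ y := mul_nonneg h.pos.le (sub_nonneg.2 huv)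
  have hmt : ∀ a : ℝ≥0∞, Measurable fun ω =>
      negExp (∑' q, if t q ω ∈ Set.Ico u v then a else 0) := fun a =>
    negExp.measurable.comp (Measurable.tsum fun q =>
      Measurable.ite (h.measurable q measurableSet_Ico) measurable_const measurable_const)
  have hhalf : 1 - ENNReal.ofReal (1 / 2) = ENNReal.ofReal (1 / 2) := by
    rw [← ENNReal.ofReal_one, ← ENNReal.ofReal_sub _ (by norm_num)]; norm_num
  have h1 := lintegral_mono (μ := P) fun ω => two_points_add_le (fun q => t q ω) u v
  rw [lintegral_add_right _ ((hmt _).const_mul 4), lintegral_add_left measurable_const,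
    lintegral_const_mul _ (hmt _), lintegral_const_mul _ (hmt _), h.laplace_Ico _ hu,
    h.laplace_Ico _ hu, negExp_ofReal_log_two, negExp.top, lintegral_const, measure_univ, mul_one,
    tsub_zero, mul_one, ← ENNReal.ofReal_mul h.pos.le, negExp.ofReal hy0,
    hhalf, ← ENNReal.ofReal_mul (sub_nonneg.2 huv), ← ENNReal.ofReal_mul h.pos.le,
    show c * ((v - u) * (1 / 2)) = y / 2 by rw [hy]; ring, negExp.ofReal (by positivity)] at h1
  change T + _ ≤ _ at h1
  have h4 : (4 : ℝ≥0∞) = ENNReal.ofReal 4 := by simp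
  have h2 : (2 : ℝ≥0∞) = ENNReal.ofReal 2 := by simp
  have hT : T ≠ ∞ := by
    refine ne_top_of_le_ne_top ?_ (le_self_add.trans h1)
    exact (ENNReal.add_lt_top.2 ⟨by simp, ENNReal.mul_lt_top (by simp) (by simp)⟩).ne
  rw [← ENNReal.ofReal_toReal hT, h4, h2, ← ENNReal.ofReal_mul (by norm_num),
    ← ENNReal.ofReal_mul (by norm_num), ← ENNReal.ofReal_add (by positivity) (by positivity),
    ← ENNReal.ofReal_add (by positivity) (by positivity),
    ENNReal.ofReal_le_ofReal_iff (by positivity)] at h1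
  rw [← ENNReal.ofReal_toReal hT]
  refine ENNReal.ofReal_le_ofReal ?_
  have h5 : Real.exp (-y) = Real.exp (-(y / 2)) ^ 2 := by
    rw [← Real.exp_nat_mul]; congr 1; push_cast; ring
  have h6 : 1 - y / 2 ≤ Real.exp (-(y / 2)) := by linarith [Real.add_one_le_exp (-(y / 2))]
  have h7 : Real.exp (-(y / 2)) ≤ 1 := Real.exp_le_one_iff.2 (by linarith)
  have h8 : (1 - Real.exp (-(y / 2))) ^ 2 ≤ (y / 2) ^ 2 :=
    pow_le_pow_left₀ (by linarith) (by linarith) 2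
  nlinarith

end IsHalfLinePoisson

/-! ### The density of the nearest point -/

namespace IsHalfLinePoisson

variable {I Ω : Type*} [Countable I] [MeasurableSpace Ω] {P : Measure Ω}
  {t : I → Ω → ℝ} {c : ℝ}

theorem measurable_nearestSum (h : IsHalfLinePoisson P t c) {γ : ℝ → ℝ} {κ : ℝ → ℝ≥0∞}
    (hγ : Measurable γ) (hκ : Measurable κ) {A : Set ℝ} (hA : MeasurableSet A) :
    Measurable fun ω => nearestSum γ κ A fun q => t q ω :=
  (_root_.measurable_nearestSum hγ hκ hA).comp h.measurable_pi

theorem lintegral_nearestSum_Ico_add_le (h : IsHalfLinePoisson P t c) {γ : ℝ → ℝ}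
    {κ : ℝ → ℝ≥0∞} (hκm : Measurable κ)
    (hγ : MonotoneOn γ (Set.Ici 0)) (hκ : MonotoneOn κ (Set.Ici 0)) {u v : ℝ} (hu : 0 ≤ u)
    (huv : u ≤ v) :
    (∫⁻ ω, nearestSum γ κ (Set.Ico u v) (fun q => t q ω) ∂P) + negExp (ENNReal.ofReal (γ u)) *
        negExp (ENNReal.ofReal c * (ENNReal.ofReal v +
          ∫⁻ y in Set.Ioi v, (1 - negExp (κ (u / y))))) ≤
      negExp (ENNReal.ofReal (γ u)) * negExp (ENNReal.ofReal c * (ENNReal.ofReal u +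
          ∫⁻ y in Set.Ioi v, (1 - negExp (κ (u / y))))) := by
  have hκ' : Measurable fun y => κ (u / y) := by fun_prop
  rw [← h.laplace_void_void hκ' hu huv, ← h.laplace_void hκ' (hu.trans huv),
    ← lintegral_const_mul', ← lintegral_const_mul', ← lintegral_add_right]
  · exact lintegral_mono fun ω => nearestSum_add_le (fun q => h.nonneg q ω) hγ hκ hu huv
  · refine (negExp.measurable.comp (Measurable.tsum fun q => ?_)).const_mul _
    exact Measurable.ite (h.measurable q measurableSet_Iio) measurable_const
      (hκ'.comp (h.measurable q))
  · exact negExp.ne_top _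
  · exact negExp.ne_top _

theorem le_lintegral_nearestSum_Ico_add [IsProbabilityMeasure P] (h : IsHalfLinePoisson P t c) {γ : ℝ → ℝ}
    {κ : ℝ → ℝ≥0∞} (hγm : Measurable γ) (hκm : Measurable κ)
    (hγ : MonotoneOn γ (Set.Ici 0)) (hκ : MonotoneOn κ (Set.Ici 0)) {u v : ℝ} (hu : 0 ≤ u)
    (huv : u ≤ v) :
    negExp (ENNReal.ofReal (γ v)) * negExp (ENNReal.ofReal c * (ENNReal.ofReal u +
          ∫⁻ y in Set.Ioi v, (1 - negExp (κ (v / y))))) ≤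
      (∫⁻ ω, nearestSum γ κ (Set.Ico u v) (fun q => t q ω) ∂P) +
        ENNReal.ofReal ((c * (v - u)) ^ 2 / 2) + negExp (ENNReal.ofReal (γ v)) *
        negExp (ENNReal.ofReal c * (ENNReal.ofReal v +
          ∫⁻ y in Set.Ioi v, (1 - negExp (κ (v / y))))) := by
  classical
  have hκ' : Measurable fun y => κ (v / y) := by fun_prop
  refine le_trans ?_ (add_le_add_left (add_le_add_right (h.lintegral_two_points_le hu huv) _) _)
  rw [← h.laplace_void_void hκ' hu huv, ← h.laplace_void hκ' (hu.trans huv),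
    ← lintegral_const_mul', ← lintegral_const_mul', ← lintegral_add_left,
    ← lintegral_add_right]
  · exact lintegral_mono fun ω => le_nearestSum_add (fun q => h.nonneg q ω) hγ hκ hu huv
  · refine (negExp.measurable.comp (Measurable.tsum fun q => ?_)).const_mul _
    exact Measurable.ite (h.measurable q measurableSet_Iio) measurable_const
      (hκ'.comp (h.measurable q))
  · exact h.measurable_nearestSum hγm hκm measurableSet_Ico
  · exact negExp.ne_top _
  · exact negExp.ne_top _

/-- The two bounds on the contribution of nearest points in `[u, v)` which determine the density
of the distance to the nearest point. -/
theorem nearestSum_Ico_bounds [IsProbabilityMeasure P] (h : IsHalfLinePoisson P t c) {γ : ℝ → ℝ}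
    {κ : ℝ → ℝ≥0∞} (hγm : Measurable γ) (hκm : Measurable κ) (hγ0 : ∀ u, 0 ≤ u → 0 ≤ γ u)
    (hκ0 : κ 0 = 0) (hγ : MonotoneOn γ (Set.Ici 0)) (hκ : MonotoneOn κ (Set.Ici 0)) {z : ℝ}
    (hz0 : 0 ≤ z)
    (hz : ∫⁻ y in Set.Ioi (1 : ℝ), (1 - negExp (κ (1 / y))) = ENNReal.ofReal z)
    {u v : ℝ} (hu : 0 ≤ u) (huv : u ≤ v) :
    c * Real.exp (-γ v - c * v * (1 + z)) * (v - u) - (c * (v - u)) ^ 2 / 2 ≤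
      (∫⁻ ω, nearestSum γ κ (Set.Ico u v) (fun q => t q ω) ∂P).toReal ∧
    (∫⁻ ω, nearestSum γ κ (Set.Ico u v) (fun q => t q ω) ∂P).toReal ≤
      c * Real.exp (-γ u - c * u * (1 + z)) * Real.exp (c * (v - u)) * (v - u) := by
  have hc := h.pos
  have hv := hu.trans huv
  have hup := h.lintegral_nearestSum_Ico_add_le hκm hγ hκ hu huv
  have hlo := h.le_lintegral_nearestSum_Ico_add hγm hκm hγ hκ hu huv
  set S := ∫⁻ ω, nearestSum γ κ (Set.Ico u v) (fun q => t q ω) ∂P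
  have hS : S ≠ ∞ := by
    refine ne_top_of_le_ne_top ENNReal.one_ne_top
      ((lintegral_mono fun ω => nearestSum_le_one γ κ _ _).trans (le_of_eq ?_))
    simp
  rw [← ENNReal.ofReal_toReal hS] at hup hlo
  set s := S.toReal
  have hs : 0 ≤ s := ENNReal.toReal_nonneg
  have hlow : ∀ w, 0 ≤ w → ENNReal.ofReal c * (ENNReal.ofReal w + ENNReal.ofReal (v * z)) =
      ENNReal.ofReal (c * (w + v * z)) := fun w hw => by
    rw [← ENNReal.ofReal_add hw (by positivity), ← ENNReal.ofReal_mul hc.le]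
  constructor
  · rw [lintegral_Ioi_scale hκm hκ0 hv, hz, ← ENNReal.ofReal_mul hv, hlow u hu, hlow v hv,
      negExp.ofReal (hγ0 v hv), negExp.ofReal (by positivity), negExp.ofReal (by positivity),
      ← ENNReal.ofReal_mul (by positivity), ← ENNReal.ofReal_mul (by positivity),
      ← ENNReal.ofReal_add hs (by positivity), ← ENNReal.ofReal_add (by positivity)
      (by positivity), ENNReal.ofReal_le_ofReal_iff (by positivity), ← Real.exp_add,
      ← Real.exp_add] at hlo
    -- With D = exp(-γ v - c v (1 + z)), the difference of the two Laplace terms is D (exp(c(v - u))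
    -- - 1), which is at least D c (v - u).
    have e1 : Real.exp (-γ v + -(c * (u + v * z))) =
        Real.exp (-γ v - c * v * (1 + z)) * Real.exp (c * (v - u)) := by
      rw [← Real.exp_add]; ring_nf
    have e2 : -γ v + -(c * (v + v * z)) = -γ v - c * v * (1 + z) := by ring
    rw [e1, e2] at hlo
    nlinarith [Real.add_one_le_exp (c * (v - u)), Real.exp_pos (-γ v - c * v * (1 + z))]
  · set B := ∫⁻ y in Set.Ioi v, (1 - negExp (κ (u / y)))
    have hscale := lintegral_Ioi_scale hκm hκ0 hu
    rw [hz, ← ENNReal.ofReal_mul hu] at hscale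
    -- Scaling evaluates the integral over (u, ∞), while only (v, ∞) occurs. The part over (u, v] is
    -- at most v - u since the integrand is at most 1; this loss is the factor exp(c(v - u)) in the
    -- upper bound.
    have hsplit : ENNReal.ofReal (u * z) ≤ ENNReal.ofReal (v - u) + B := by
      rw [← hscale, ← Set.Ioc_union_Ioi_eq_Ioi huv]
      refine (lintegral_union_le _ _ _).trans (add_le_add_left ?_ _)
      refine (setLIntegral_mono measurable_const fun y _ => tsub_le_self).trans (le_of_eq ?_)
      rw [setLIntegral_one, Real.volume_Ioc]
    have hB : B ≠ ∞ := by
      refine ne_top_of_le_ne_top (ENNReal.ofReal_ne_top (r := u * z)) ?_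
      rw [← hscale]
      exact lintegral_mono_set (Set.Ioi_subset_Ioi huv)
    rw [← ENNReal.ofReal_toReal hB] at hup hsplit
    set b := B.toReal
    have hb : 0 ≤ b := ENNReal.toReal_nonneg
    rw [← ENNReal.ofReal_add (sub_nonneg.2 huv) hb, ENNReal.ofReal_le_ofReal_iff
      (add_nonneg (sub_nonneg.2 huv) hb)] at hsplit
    rw [← ENNReal.ofReal_add hv hb, ← ENNReal.ofReal_add hu hb, ← ENNReal.ofReal_mul hc.le,
      ← ENNReal.ofReal_mul hc.le, negExp.ofReal (hγ0 u hu), negExp.ofReal (by positivity),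
      negExp.ofReal (by positivity), ← ENNReal.ofReal_mul (by positivity),
      ← ENNReal.ofReal_mul (by positivity), ← ENNReal.ofReal_add hs (by positivity),
      ENNReal.ofReal_le_ofReal_iff (by positivity), ← Real.exp_add, ← Real.exp_add] at hup
    have e1 : Real.exp (-γ u + -(c * (v + b))) =
        Real.exp (-γ u + -(c * (u + b))) * Real.exp (-(c * (v - u))) := by
      rw [← Real.exp_add]; ring_nf
    have e2 : Real.exp (-γ u + -(c * (u + b))) ≤
        Real.exp (-γ u - c * u * (1 + z)) * Real.exp (c * (v - u)) := by
      rw [← Real.exp_add, Real.exp_le_exp]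
      nlinarith
    have e3 : 1 - Real.exp (-(c * (v - u))) ≤ c * (v - u) := by
      linarith [Real.add_one_le_exp (-(c * (v - u)))]
    calc s ≤ Real.exp (-γ u + -(c * (u + b))) * (1 - Real.exp (-(c * (v - u)))) := by
          rw [e1] at hup; linarith
      _ ≤ Real.exp (-γ u + -(c * (u + b))) * (c * (v - u)) := by gcongr
      _ ≤ (Real.exp (-γ u - c * u * (1 + z)) * Real.exp (c * (v - u))) * (c * (v - u)) := by
          have : 0 ≤ c * (v - u) := mul_nonneg hc.le (sub_nonneg.2 huv)
          gcongr
      _ = _ := by ring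

/-- The expectation of a functional of the nearest point and of the ratios of the other points
to it. -/
theorem lintegral_nearestSum [IsProbabilityMeasure P] (h : IsHalfLinePoisson P t c) {γ : ℝ → ℝ}
    {κ : ℝ → ℝ≥0∞} (hγc : Continuous γ) (hκm : Measurable κ) (hγ0 : ∀ u, 0 ≤ u → 0 ≤ γ u)
    (hκ0 : κ 0 = 0) (hγ : MonotoneOn γ (Set.Ici 0)) (hκ : MonotoneOn κ (Set.Ici 0)) {z : ℝ}
    (hz0 : 0 ≤ z)
    (hz : ∫⁻ y in Set.Ioi (1 : ℝ), (1 - negExp (κ (1 / y))) = ENNReal.ofReal z) :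
    (∫⁻ ω, nearestSum γ κ Set.univ (fun q => t q ω) ∂P).toReal =
      ∫ u in Set.Ioi (0 : ℝ), c * Real.exp (-γ u - c * u * (1 + z)) := by
  have hc := h.pos
  have hγm := hγc.measurable
  set F : ℝ → ℝ := fun u => c * Real.exp (-γ u - c * u * (1 + z)) with hF
  have hFc : Continuous F := by fun_prop
  have hF0 : ∀ u, 0 ≤ F u := fun u => by positivity
  have hFle : ∀ u, 0 ≤ u → F u ≤ c * Real.exp (-c * u) := fun u hu => by
    have := hγ0 u hu
    have h2 : 0 ≤ c * u * z := by positivity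
    have h3 : Real.exp (-γ u - c * u * (1 + z)) ≤ Real.exp (-c * u) :=
      Real.exp_le_exp.2 (by nlinarith)
    exact mul_le_mul_of_nonneg_left h3 hc.le
  have hFc' : ∀ u, 0 ≤ u → F u ≤ c := fun u hu =>
    (hFle u hu).trans (mul_le_of_le_one_right hc.le (Real.exp_le_one_iff.2 (by nlinarith)))
  have hFi : IntegrableOn F (Set.Ioi 0) := by
    refine Integrable.mono' ((exp_neg_integrableOn_Ioi 0 hc).const_mul c)
      hFc.aestronglyMeasurable ?_
    refine (ae_restrict_iff' measurableSet_Ioi).2 (Eventually.of_forall fun u hu => ?_)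
    rw [Real.norm_of_nonneg (hF0 u)]
    exact hFle u (le_of_lt hu)
  set S : Set ℝ → ℝ≥0∞ := fun A => ∫⁻ ω, nearestSum γ κ A (fun q => t q ω) ∂P with hS
  have hSfin : ∀ A, S A ≠ ∞ := fun A => by
    refine ne_top_of_le_ne_top ENNReal.one_ne_top
      ((lintegral_mono fun ω => nearestSum_le_one γ κ _ _).trans (le_of_eq ?_))
    simp
  -- The contribution of nearest points in [0, u). Its difference quotients to the right of u are
  -- squeezed to F u, and continuity together with this right derivative suffices for the
  -- fundamental theorem of calculus.
  set H : ℝ → ℝ := fun u => (S (Set.Ico 0 u)).toReal with hH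
  have hdiff : ∀ u v, 0 ≤ u → u ≤ v → H v - H u = (S (Set.Ico u v)).toReal := by
    intro u v hu huv
    have : S (Set.Ico 0 v) = S (Set.Ico 0 u) + S (Set.Ico u v) := by
      simp only [hS]
      rw [← lintegral_add_left (h.measurable_nearestSum hγm hκm measurableSet_Ico),
        ← Set.Ico_union_Ico_eq_Ico hu huv]
      exact lintegral_congr fun ω => nearestSum_union
        (Set.disjoint_left.2 fun y hy hy' => not_lt.2 hy'.1 hy.2) _ _ _
    simp only [hH]
    rw [this, ENNReal.toReal_add (hSfin _) (hSfin _)]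
    ring
  have hb : ∀ u v, 0 ≤ u → u ≤ v → F v * (v - u) - (c * (v - u)) ^ 2 / 2 ≤ H v - H u ∧
      H v - H u ≤ F u * Real.exp (c * (v - u)) * (v - u) := by
    intro u v hu huv
    rw [hdiff u v hu huv]
    exact h.nearestSum_Ico_bounds hγm hκm hγ0 hκ0 hγ hκ hz0 hz hu huv
  have hderiv : ∀ u, 0 ≤ u → HasDerivWithinAt H (F u) (Set.Ioi u) u := by
    intro u hu
    rw [hasDerivWithinAt_iff_tendsto_slope' (by simp)]
    have hlow : Tendsto (fun v => F v - c ^ 2 * (v - u) / 2) (𝓝[>] u) (𝓝 (F u)) := by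
      have : Continuous fun v => F v - c ^ 2 * (v - u) / 2 := by fun_prop
      simpa using (this.tendsto u).mono_left nhdsWithin_le_nhds
    have hupp : Tendsto (fun v => F u * Real.exp (c * (v - u))) (𝓝[>] u) (𝓝 (F u)) := by
      have : Continuous fun v => F u * Real.exp (c * (v - u)) := by fun_prop
      simpa using (this.tendsto u).mono_left nhdsWithin_le_nhds
    refine tendsto_of_tendsto_of_tendsto_of_le_of_le' hlow hupp ?_ ?_
    · filter_upwards [self_mem_nhdsWithin] with v hv
      have hv : 0 < v - u := sub_pos.2 hv
      rw [slope_def_field, le_div_iff₀ hv]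
      refine le_trans (le_of_eq ?_) (hb u v hu (by linarith)).1
      ring
    · filter_upwards [self_mem_nhdsWithin] with v hv
      have hv : 0 < v - u := sub_pos.2 hv
      rw [slope_def_field, div_le_iff₀ hv]
      exact (hb u v hu (by linarith)).2
  have hcont : ∀ n : ℝ, 0 ≤ n → ContinuousOn H (Set.Icc 0 n) := by
    intro n hn
    -- The constant comes from the upper bound on increments, with F ≤ c and v - u ≤ n.
    have hlip : ∀ u ∈ Set.Icc 0 n, ∀ v ∈ Set.Icc 0 n, u ≤ v →
        |H u - H v| ≤ c * Real.exp (c * n) * |u - v| := by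
      intro u hu v hv huv
      have h0 : 0 ≤ H v - H u := by
        rw [hdiff u v hu.1 huv]; exact ENNReal.toReal_nonneg
      rw [abs_sub_comm, abs_sub_comm u, abs_of_nonneg h0, abs_of_nonneg (sub_nonneg.2 huv)]
      refine (hb u v hu.1 huv).2.trans ?_
      have h1 := hFc' u hu.1
      have h2 : c * (v - u) ≤ c * n := by
        have := hu.1; have := hv.2; gcongr; linarith
      have h3 := sub_nonneg.2 huv
      gcongr
    refine LipschitzOnWith.continuousOn (K := (c * Real.exp (c * n)).toNNReal) ?_
    refine LipschitzOnWith.of_dist_le_mul fun u hu v hv => ?_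
    rw [Real.coe_toNNReal _ (by positivity), Real.dist_eq, Real.dist_eq]
    rcases le_total u v with huv | huv
    · exact hlip u hu v hv huv
    · rw [abs_sub_comm, abs_sub_comm u]
      exact hlip v hv u hu huv
  have hint : ∀ n : ℝ, 0 ≤ n → ∫ u in (0 : ℝ)..n, F u = H n := by
    intro n hn
    rw [intervalIntegral.integral_eq_sub_of_hasDeriv_right_of_le hn (hcont n hn)
      (fun u hu => hderiv u hu.1.le) (hFc.intervalIntegrable 0 n)]
    have : H 0 = 0 := by
      simp only [hH, hS, Set.Ico_self]
      rw [lintegral_congr fun ω => nearestSum_eq_zero γ κ fun s _ => Set.notMem_empty _]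
      simp
    rw [this, sub_zero]
  have hlim1 : Tendsto (fun n : ℕ => ∫ u in (0 : ℝ)..n, F u) atTop
      (𝓝 (∫ u in Set.Ioi (0 : ℝ), F u)) :=
    intervalIntegral_tendsto_integral_Ioi 0 hFi tendsto_natCast_atTop_atTop
  have hlim2 : Tendsto (fun n : ℕ => H n) atTop (𝓝 (S Set.univ).toReal) := by
    refine (ENNReal.tendsto_toReal (hSfin _)).comp ?_
    refine tendsto_lintegral_of_dominated_convergence (fun _ => 1)
      (fun n => h.measurable_nearestSum hγm hκm measurableSet_Ico)
      (fun n => Eventually.of_forall fun ω => nearestSum_le_one _ _ _ _) (by simp)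
      (Eventually.of_forall fun ω => ?_)
    by_cases hs : ∃ s, IsNearest (fun q => t q ω) s
    · obtain ⟨s, hs⟩ := hs
      refine tendsto_const_nhds.congr' ?_
      filter_upwards [eventually_gt_atTop ⌈t s ω⌉₊] with n hn
      rw [nearestSum_of_isNearest hs γ κ (Set.mem_univ _), nearestSum_of_isNearest hs γ κ]
      exact ⟨h.nonneg s ω, (Nat.le_ceil _).trans_lt (by exact_mod_cast hn)⟩
    · push Not at hs
      simp only [nearestSum_eq_zero γ κ fun s h' => absurd h' (hs s)]
      exact tendsto_const_nhds
  simp only [fun n : ℕ => hint n n.cast_nonneg] at hlim1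
  exact tendsto_nhds_unique hlim2 hlim1

end IsHalfLinePoisson

/-! ### The interference integral and the hypergeometric function -/

/-- The `l`-th power of the fraction `θ y ^ (-α/2) / (1 + θ y ^ (-α/2))` integrates
to `interferenceZ`. -/
theorem integral_interference_pow {θ α : ℝ} (hθ : 0 < θ) (hα : 2 < α) {l : ℕ} (hl : 1 ≤ l) :
    IntegrableOn (fun y : ℝ => (θ * y ^ (-(α / 2)) / (1 + θ * y ^ (-(α / 2)))) ^ l)
      (Set.Ioi 1) ∧
    ∫ y in Set.Ioi (1 : ℝ), (θ * y ^ (-(α / 2)) / (1 + θ * y ^ (-(α / 2)))) ^ l =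
      interferenceZ θ α l := by
  have hα0 : 0 < α := by linarith
  have hl' : (1 : ℝ) ≤ l := by exact_mod_cast hl
  set g : ℝ → ℝ := fun y => (θ * y ^ (-(α / 2)) / (1 + θ * y ^ (-(α / 2)))) ^ l with hg
  -- The substitution y = x^p sends (0, 1) to (1, ∞) and y^(-α/2) to x. The Jacobian factor x^(p -
  -- 1) times x^l is x^(b - 1), the weight in Euler's integral, and b > 0 because 2/α < 1 ≤ l.
  set p : ℝ := -(2 / α) with hp
  have hp0 : p < 0 := by rw [hp]; simp [hα0]
  set b : ℝ := l - 2 / α with hb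
  have hb0 : 0 < b := by
    have : 2 / α < 1 := (div_lt_one hα0).2 hα
    rw [hb]; linarith
  have hsub : ∀ x ∈ Set.Ioi (0 : ℝ), (|p| * x ^ (p - 1)) • (Set.Ioi (1 : ℝ)).indicator g (x ^ p) =
      (Set.Ioo (0 : ℝ) 1).indicator
        (fun t => 2 / α * θ ^ l * (t ^ (b - 1) * (1 - -θ * t) ^ (-(l : ℝ)))) x := by
    intro x hx
    have hx : 0 < x := hx
    by_cases hx1 : x < 1
    · rw [Set.indicator_of_mem (Set.mem_Ioi.2 (Real.one_lt_rpow_of_pos_of_lt_one_of_neg hx hx1 hp0)),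
        Set.indicator_of_mem (Set.mem_Ioo.2 ⟨hx, hx1⟩)]
      have h1 : (x ^ p) ^ (-(α / 2)) = x := by
        rw [← Real.rpow_mul hx.le, show p * -(α / 2) = 1 by rw [hp]; field_simp, Real.rpow_one]
      have h2 : (1 - -θ * x) ^ (-(l : ℝ)) = ((1 + θ * x) ^ l)⁻¹ := by
        rw [Real.rpow_neg (by nlinarith), Real.rpow_natCast]; congr 2; ring
      have h3 : x ^ (b - 1) = x ^ (p - 1) * x ^ l := by
        rw [← Real.rpow_natCast, ← Real.rpow_add hx, hb, hp]; congr 1; ring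
      simp only [hg, smul_eq_mul]
      rw [h1, h2, h3, abs_of_neg hp0, hp, neg_neg, div_pow, mul_pow]
      ring
    · rw [Set.indicator_of_notMem, Set.indicator_of_notMem, smul_zero]
      · exact fun h => hx1 h.2
      · rw [Set.mem_Ioi, not_lt]
        exact Real.rpow_le_one_of_one_le_of_nonpos (not_lt.1 hx1) hp0.le
  have hint : IntegrableOn ((Set.Ioo (0 : ℝ) 1).indicator
      (fun t => 2 / α * θ ^ l * (t ^ (b - 1) * (1 - -θ * t) ^ (-(l : ℝ))))) (Set.Ioi 0) := by
    refine Integrable.integrableOn ((integrable_indicator_iff measurableSet_Ioo).2 ?_)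
    exact ((integrable_euler (l : ℝ) hb0 (by linarith : -θ < 1)).mono_set
      Set.Ioo_subset_Ioc_self).const_mul _
  constructor
  · have h1 := (integrableOn_congr_fun hsub measurableSet_Ioi).2 hint
    rw [integrableOn_Ioi_comp_rpow_iff _ hp0.ne] at h1
    have h2 := h1.mono_set (Set.Ioi_subset_Ioi (zero_le_one (α := ℝ)))
    exact (integrableOn_congr_fun (fun y hy => Set.indicator_of_mem hy g) measurableSet_Ioi).1 h2
  · have h1 := integral_comp_rpow_Ioi ((Set.Ioi (1 : ℝ)).indicator g) hp0.ne
    rw [setIntegral_congr_fun measurableSet_Ioi hsub, setIntegral_indicator measurableSet_Ioo,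
      setIntegral_indicator measurableSet_Ioi, Set.inter_eq_right.2 Set.Ioo_subset_Ioi_self,
      Set.inter_eq_right.2 (Set.Ioi_subset_Ioi (zero_le_one (α := ℝ))), integral_const_mul,
      ← integral_Ioc_eq_integral_Ioo] at h1
    rw [← h1, interferenceZ, gaussHypergeometric_eq _ hb0 (by linarith), ← mul_assoc]
    congr 1
    -- Since b = (lα - 2)/α, the factor b of Euler's integral turns 2θ^l/(lα - 2) into (2/α)θ^l.
    have : (l : ℝ) * α - 2 ≠ 0 := by nlinarith
    rw [hb]
    field_simp
    rw [div_self]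
    rwa [mul_comm]

/-- The binomial theorem for 1/(1 + w) = 1 - w/(1 + w). With w = θ y^(-α/2), each power of w/(1 + w)
is integrable on (1, ∞), so the terms can be integrated separately. -/
theorem one_sub_inv_pow_eq_sum {w : ℝ} (hw : 0 ≤ w) (m : ℕ) :
    1 - ((1 + w)⁻¹) ^ m =
      ∑ l ∈ Finset.Icc 1 m, (m.choose l : ℝ) * (-1) ^ (l + 1) * (w / (1 + w)) ^ l := by
  have h0 : 1 + w ≠ 0 := by positivity
  have h1 : (1 + w)⁻¹ = -(w / (1 + w)) + 1 := by field_simp; ring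
  rw [h1, add_pow, Finset.range_eq_Ico, Finset.sum_eq_sum_Ico_succ_bot (by omega)]
  have : Finset.Ico (0 + 1) (m + 1) = Finset.Icc 1 m := by ext; simp
  rw [this]
  simp only [pow_zero, one_pow, mul_one, Nat.choose_zero_right, Nat.cast_one,
    sub_add_eq_sub_sub, sub_self, zero_sub, ← Finset.sum_neg_distrib]
  refine Finset.sum_congr rfl fun l _ => ?_
  rw [neg_pow]; ring

/-- The exponent with which an interferer at squared distance `y` contributes to the coverage in
`m` bands when the server is at squared distance `z * y`. -/
noncomputable def interferenceExponent (θ α : ℝ) (m : ℕ) (z : ℝ) : ℝ≥0∞ :=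
  m * ENNReal.ofReal (Real.log (1 + θ * z ^ (α / 2)))

theorem negExp_ofReal_log {w : ℝ} (hw : 0 ≤ w) :
    negExp (ENNReal.ofReal (Real.log (1 + w))) = ENNReal.ofReal ((1 + w)⁻¹) := by
  rw [negExp.ofReal (Real.log_nonneg (by linarith)), Real.exp_neg, Real.exp_log (by linarith)]

theorem measurable_interferenceExponent (θ α : ℝ) (m : ℕ) :
    Measurable (interferenceExponent θ α m) := by
  unfold interferenceExponent; fun_prop

theorem monotoneOn_interferenceExponent {θ α : ℝ} (hθ : 0 < θ) (hα : 2 < α) (m : ℕ) :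
    MonotoneOn (interferenceExponent θ α m) (Set.Ici 0) := by
  intro x hx y hy hxy
  have hx : 0 ≤ x := hx
  unfold interferenceExponent
  gcongr

theorem interferenceExponent_zero (θ : ℝ) {α : ℝ} (hα : 2 < α) (m : ℕ) :
    interferenceExponent θ α m 0 = 0 := by
  rw [interferenceExponent, Real.zero_rpow (by linarith)]; simp

/-- This evaluates the constant z of `IsHalfLinePoisson.lintegral_nearestSum`. The alternating sum
is nonnegative because it is the integral of a nonnegative function. -/
theorem lintegral_interferenceExponent {θ α : ℝ} (hθ : 0 < θ) (hα : 2 < α) (m : ℕ) :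
    0 ≤ ∑ l ∈ Finset.Icc 1 m, (m.choose l : ℝ) * (-1) ^ (l + 1) * interferenceZ θ α l ∧
    ∫⁻ y in Set.Ioi (1 : ℝ), (1 - negExp (interferenceExponent θ α m (1 / y))) =
      ENNReal.ofReal
        (∑ l ∈ Finset.Icc 1 m, (m.choose l : ℝ) * (-1) ^ (l + 1) * interferenceZ θ α l) := by
  set f : ℝ → ℝ := fun y => 1 - ((1 + θ * y ^ (-(α / 2)))⁻¹) ^ m with hf
  have hw : ∀ y ∈ Set.Ioi (1 : ℝ), 0 ≤ θ * y ^ (-(α / 2)) := fun y hy => by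
    have : (0 : ℝ) < y := zero_lt_one.trans hy
    positivity
  have hf0 : ∀ y ∈ Set.Ioi (1 : ℝ), 0 ≤ f y := fun y hy => by
    have := hw y hy
    have h1 : ((1 + θ * y ^ (-(α / 2)))⁻¹) ^ m ≤ 1 :=
      pow_le_one₀ (by positivity) (inv_le_one_of_one_le₀ (by linarith))
    simp only [hf]; linarith
  have hfs : ∀ y ∈ Set.Ioi (1 : ℝ), f y = ∑ l ∈ Finset.Icc 1 m, (m.choose l : ℝ) * (-1) ^ (l + 1) *
      (θ * y ^ (-(α / 2)) / (1 + θ * y ^ (-(α / 2)))) ^ l := fun y hy =>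
    one_sub_inv_pow_eq_sum (hw y hy) m
  have hi : ∀ l ∈ Finset.Icc 1 m, IntegrableOn (fun y : ℝ => (m.choose l : ℝ) * (-1) ^ (l + 1) *
      (θ * y ^ (-(α / 2)) / (1 + θ * y ^ (-(α / 2)))) ^ l) (Set.Ioi 1) := fun l hl =>
    (integral_interference_pow hθ hα (Finset.mem_Icc.1 hl).1).1.const_mul _
  have hfi : IntegrableOn f (Set.Ioi 1) :=
    (integrableOn_congr_fun hfs measurableSet_Ioi).2 (integrable_finsetSum _ hi)
  have hval : ∫ y in Set.Ioi (1 : ℝ), f y =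
      ∑ l ∈ Finset.Icc 1 m, (m.choose l : ℝ) * (-1) ^ (l + 1) * interferenceZ θ α l := by
    rw [setIntegral_congr_fun measurableSet_Ioi hfs, integral_finsetSum _ hi]
    refine Finset.sum_congr rfl fun l hl => ?_
    rw [integral_const_mul, (integral_interference_pow hθ hα (Finset.mem_Icc.1 hl).1).2]
  have hnn := (ae_restrict_iff' (μ := volume) measurableSet_Ioi).2 (Eventually.of_forall hf0)
  rw [← hval]
  refine ⟨integral_nonneg_of_ae hnn, ?_⟩
  rw [ofReal_integral_eq_lintegral_ofReal hfi hnn]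
  refine setLIntegral_congr_fun measurableSet_Ioi fun y hy => ?_
  have hy0 : (0 : ℝ) < y := zero_lt_one.trans hy
  have h1 : (1 / y) ^ (α / 2) = y ^ (-(α / 2)) := by
    rw [one_div, Real.inv_rpow hy0.le, Real.rpow_neg hy0.le]
  have h2 := hw y hy
  simp only [interferenceExponent, hf]
  rw [h1, negExp.natCast_mul, negExp_ofReal_log h2, ← ENNReal.ofReal_pow (by positivity),
    ENNReal.ofReal_sub _ (by positivity), ENNReal.ofReal_one]

/-! ### Coverage at fixed locations -/

/-- Grouping independent random variables along the first coordinate of their index. -/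
theorem iIndepFun_curry {Ω ι κ E : Type*} [MeasurableSpace Ω] [MeasurableSpace E] {P : Measure Ω}
    {X : ι × κ → Ω → E} (mX : ∀ p, Measurable (X p)) (h : iIndepFun X P) :
    iIndepFun (fun i ω j => X (i, j) ω) P := by
  have := h.isProbabilityMeasure
  have hpr : ∀ p, IsProbabilityMeasure (P.map (X p)) := fun p =>
    Measure.isProbabilityMeasure_map (mX p).aemeasurable
  rw [iIndepFun_iff_map_fun_eq_infinitePi_map (fun i => measurable_pi_lambda _ fun j => mX (i, j))]
  have h1 : ∀ i, P.map (fun ω j => X (i, j) ω) =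
      Measure.infinitePi fun j => P.map (X (i, j)) := fun i =>
    (h.precomp (g := fun j => (i, j)) (Prod.mk_right_injective i)).map_fun_eq_infinitePi_map
      fun j => mX (i, j)
  simp only [h1]
  rw [← Measure.infinitePi_map_curry (fun i j => P.map (X (i, j))),
    ← h.map_fun_eq_infinitePi_map mX, Measure.map_map (MeasurableEquiv.measurable _)
      (measurable_pi_lambda _ mX)]
  rfl

/-- One of independent random variables is independent of all others. -/
theorem indepFun_subtype_ne {Ω ι E : Type*} [MeasurableSpace Ω] [MeasurableSpace E] {P : Measure Ω}
    {X : ι → Ω → E} (mX : ∀ i, Measurable (X i)) (h : iIndepFun X P) (s : ι) :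
    IndepFun (X s) (fun ω (q : {q // q ≠ s}) => X q ω) P := by
  have h1 := indep_iSup_of_disjoint (fun i => (mX i).comap_le) h.iIndep
    (S := {s}) (T := {q | q ≠ s}) (by simp)
  rw [IndepFun_iff_Indep]
  refine indep_of_indep_of_le_left (indep_of_indep_of_le_right h1 ?_) ?_
  · rw [MeasurableSpace.pi, MeasurableSpace.comap_iSup]
    refine iSup_le fun q => ?_
    rw [MeasurableSpace.comap_comp]
    exact le_iSup₂_of_le (q : ι) q.2 le_rfl
  · exact le_iSup₂_of_le s rfl le_rfl

theorem expMeasure_Ioi {y : ℝ} (hy : 0 ≤ y) :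
    expMeasure 1 (Set.Ioi y) = ENNReal.ofReal (Real.exp (-y)) := by
  have := isProbabilityMeasure_expMeasure (zero_lt_one (α := ℝ))
  have h1 := cdf_expMeasure_eq (zero_lt_one (α := ℝ)) y
  rw [cdf_eq_real, if_pos hy, one_mul] at h1
  rw [← ofReal_measureReal, ← Set.compl_Iic, probReal_compl_eq_one_sub measurableSet_Iic, h1,
    sub_sub_cancel]

/-- The exponential tail at c/ℓ. Allowing `c = ∞`, where both sides vanish, makes it unnecessary to
show that the interference is finite. -/
theorem expMeasure_lt_ofReal_mul {ℓ : ℝ} (hℓ : 0 < ℓ) (c : ℝ≥0∞) :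
    expMeasure 1 {a : ℝ | c < ENNReal.ofReal (a * ℓ)} = negExp (c * ENNReal.ofReal ℓ⁻¹) := by
  rcases eq_or_ne c ∞ with rfl | hc
  · rw [ENNReal.top_mul (by simpa using hℓ)]; simp
  · obtain ⟨r, hr, rfl⟩ : ∃ r : ℝ, 0 ≤ r ∧ c = ENNReal.ofReal r :=
      ⟨c.toReal, ENNReal.toReal_nonneg, (ENNReal.ofReal_toReal hc).symm⟩
    have : {a : ℝ | ENNReal.ofReal r < ENNReal.ofReal (a * ℓ)} = Set.Ioi (r / ℓ) := by
      ext a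
      simp only [Set.mem_ofPred_eq, Set.mem_Ioi]
      rw [ENNReal.ofReal_lt_ofReal_iff_of_nonneg hr, div_lt_iff₀ hℓ]
    rw [this, expMeasure_Ioi (by positivity), ← ENNReal.ofReal_mul hr,
      negExp.ofReal (by positivity), div_eq_mul_inv]

/-- Tilting the unit-rate exponential density by exp(-a w) gives 1/(1 + w) times the density of rate
1 + w. The value is written as exp(-log(1 + w)) so that products over interferers become sums of
exponents. -/
theorem lintegral_negExp_expMeasure {w : ℝ} (hw : 0 ≤ w) :
    ∫⁻ a, negExp (ENNReal.ofReal (a * w)) ∂(expMeasure 1) =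
      negExp (ENNReal.ofReal (Real.log (1 + w))) := by
  have hw1 : 0 < 1 + w := by linarith
  rw [negExp_ofReal_log hw]
  have hm : Measurable (exponentialPDF 1) := (measurable_exponentialPDFReal 1).ennreal_ofReal
  have hm' : Measurable (exponentialPDF (1 + w)) :=
    (measurable_exponentialPDFReal (1 + w)).ennreal_ofReal
  change ∫⁻ a, _ ∂(volume.withDensity (exponentialPDF 1)) = _
  rw [lintegral_withDensity_eq_lintegral_mul _ hm (by fun_prop)]
  have : ∀ a, (exponentialPDF 1 * fun a => negExp (ENNReal.ofReal (a * w))) a =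
      ENNReal.ofReal ((1 + w)⁻¹) * exponentialPDF (1 + w) a := by
    intro a
    rw [Pi.mul_apply]
    rcases lt_or_ge a 0 with ha | ha
    · rw [exponentialPDF_of_neg ha, exponentialPDF_of_neg ha]; simp
    · rw [exponentialPDF_of_nonneg ha, exponentialPDF_of_nonneg ha,
        negExp.ofReal (mul_nonneg ha hw), ← ENNReal.ofReal_mul (by positivity),
        ← ENNReal.ofReal_mul (by positivity), ← mul_assoc, inv_mul_cancel₀ hw1.ne', one_mul,
        one_mul, ← Real.exp_add]
      ring_nf
  simp only [this]
  rw [lintegral_const_mul _ hm', lintegral_exponentialPDF_eq_one hw1, mul_one]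

/-- The Laplace transform of a countable weighted sum of independent exponential variables. -/
theorem lintegral_negExp_tsum_exponential {Ω ι : Type*} [Countable ι] [MeasurableSpace Ω]
    {P : Measure Ω} [IsProbabilityMeasure P] {G : ι → Ω → ℝ} (mG : ∀ i, Measurable (G i))
    (hG : iIndepFun G P) (lG : ∀ i, HasLaw (G i) (expMeasure 1) P) {w : ι → ℝ}
    (hw : ∀ i, 0 ≤ w i) :
    ∫⁻ ω, negExp (∑' i, ENNReal.ofReal (G i ω * w i)) ∂P =
      negExp (∑' i, ENNReal.ofReal (Real.log (1 + w i))) := by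
  have h1 : ∀ F : Finset ι, ∫⁻ ω, negExp (∑ i ∈ F, ENNReal.ofReal (G i ω * w i)) ∂P =
      negExp (∑ i ∈ F, ENNReal.ofReal (Real.log (1 + w i))) := by
    intro F
    simp only [negExp.sum]
    refine (lintegral_prod_eq_prod_lintegral_of_indepFun F _
      (hG.comp (fun i a => negExp (ENNReal.ofReal (a * w i))) fun i => by fun_prop)
      fun i => by have := mG i; simp only [Function.comp_def]; fun_prop).trans ?_
    refine Finset.prod_congr rfl fun i _ => ?_
    rw [← lintegral_negExp_expMeasure (hw i)]
    exact (lG i).lintegral_comp (f := fun a => negExp (ENNReal.ofReal (a * w i))) (by fun_prop)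
  refine tendsto_nhds_unique ?_ (negExp.tendsto_finset_sum fun i =>
    ENNReal.ofReal (Real.log (1 + w i)))
  simp only [← h1]
  -- Dominated convergence along the finite subsets of ι; countability of ι makes this filter
  -- countably generated.
  refine tendsto_lintegral_filter_of_dominated_convergence (fun _ => 1)
    (Eventually.of_forall fun F => ?_)
    (Eventually.of_forall fun F => Eventually.of_forall fun ω => negExp.le_one _) (by simp)
    (Eventually.of_forall fun ω => negExp.tendsto_finset_sum _)
  exact negExp.measurable.comp (Finset.measurable_sum F fun i _ => by have := mG i; fun_prop)

/-- The probability that the signal-to-interference-and-noise ratio exceeds the threshold `θ` in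
one band, at fixed path losses `ℓ`. -/
theorem measure_lt_SINR {Ω ι : Type*} [Countable ι] [MeasurableSpace Ω]
    {P : Measure Ω} [IsProbabilityMeasure P] {G : ι → Ω → ℝ} (mG : ∀ i, Measurable (G i))
    (hG : iIndepFun G P) (lG : ∀ i, HasLaw (G i) (expMeasure 1) P) {ℓ : ι → ℝ}
    (hℓ : ∀ i, 0 ≤ ℓ i) {s : ι} (hs : 0 < ℓ s) {b θ : ℝ} (hb : 0 ≤ b) (hθ : 0 < θ) :
    P {ω | ENNReal.ofReal θ < ENNReal.ofReal (G s ω * ℓ s) /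
        (ENNReal.ofReal b + ∑' q : {q // q ≠ s}, ENNReal.ofReal (G q ω * ℓ q))} =
      negExp (ENNReal.ofReal (θ * b / ℓ s) +
        ∑' q : {q // q ≠ s}, ENNReal.ofReal (Real.log (1 + θ * (ℓ q / ℓ s)))) := by
  -- The level that the received signal has to exceed. It depends only on the fadings of the
  -- interferers, hence is independent of the fading of the server.
  set J : ({q // q ≠ s} → ℝ) → ℝ≥0∞ := fun g =>
    ENNReal.ofReal θ * (ENNReal.ofReal b + ∑' q : {q // q ≠ s}, ENNReal.ofReal (g q * ℓ q)) with hJ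
  have hJm : Measurable J := by
    have : Measurable fun g : {q // q ≠ s} → ℝ =>
        ∑' q : {q // q ≠ s}, ENNReal.ofReal (g q * ℓ q) :=
      Measurable.tsum fun q => by fun_prop
    fun_prop
  set R : Ω → {q // q ≠ s} → ℝ := fun ω q => G q ω with hR
  have hRm : Measurable R := measurable_pi_lambda _ fun q => mG q
  have hset : {ω | ENNReal.ofReal θ < ENNReal.ofReal (G s ω * ℓ s) /
      (ENNReal.ofReal b + ∑' q : {q // q ≠ s}, ENNReal.ofReal (G q ω * ℓ q))} =
      (fun ω => (G s ω, R ω)) ⁻¹' {p | J p.2 < ENNReal.ofReal (p.1 * ℓ s)} := by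
    ext ω
    simp only [Set.mem_ofPred_eq, Set.mem_preimage, hJ]
    -- As θ is neither 0 nor `∞`, clearing the denominator is valid even when noise plus
    -- interference is 0 or `∞`.
    rw [ENNReal.lt_div_iff_mul_lt (Or.inr ENNReal.ofReal_ne_top)
      (Or.inr (by simpa using hθ))]
  have hmeas : MeasurableSet {p : ℝ × ({q // q ≠ s} → ℝ) |
      J p.2 < ENNReal.ofReal (p.1 * ℓ s)} :=
    measurableSet_lt (hJm.comp measurable_snd) (by fun_prop)
  have hind := indepFun_subtype_ne mG hG s
  rw [indepFun_iff_map_prod_eq_prod_map_map (mG s).aemeasurable hRm.aemeasurable] at hind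
  rw [hset, ← Measure.map_apply ((mG s).prodMk hRm) hmeas, hind, (lG s).map_eq]
  have := isProbabilityMeasure_expMeasure (zero_lt_one (α := ℝ))
  have := Measure.isProbabilityMeasure_map (μ := P) hRm.aemeasurable
  rw [Measure.prod_apply_symm hmeas]
  have h1 : ∀ g, expMeasure 1 ((fun x => (x, g)) ⁻¹'
      {p : ℝ × ({q // q ≠ s} → ℝ) | J p.2 < ENNReal.ofReal (p.1 * ℓ s)}) =
      negExp (J g * ENNReal.ofReal (ℓ s)⁻¹) := fun g => expMeasure_lt_ofReal_mul hs (J g)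
  simp only [h1]
  rw [lintegral_map (by fun_prop) hRm]
  have h2 : ∀ ω, negExp (J (R ω) * ENNReal.ofReal (ℓ s)⁻¹) = negExp (ENNReal.ofReal (θ * b / ℓ s)) *
      negExp (∑' q : {q // q ≠ s}, ENNReal.ofReal (G q ω * (θ * (ℓ q / ℓ s)))) := by
    intro ω
    rw [← negExp.add]
    congr 1
    simp only [hJ]
    rw [mul_add, add_mul, ← ENNReal.ofReal_mul hθ.le, ← ENNReal.ofReal_mul (by positivity),
      ← div_eq_mul_inv, mul_right_comm, ← ENNReal.ofReal_mul hθ.le, ← ENNReal.tsum_mul_left]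
    congr 1
    refine tsum_congr fun q => ?_
    rw [← ENNReal.ofReal_mul (by positivity)]
    congr 1
    simp only [hR]
    ring
  simp only [h2]
  rw [lintegral_const_mul' _ _ (negExp.ne_top _), lintegral_negExp_tsum_exponential
    (G := fun q : {q // q ≠ s} => G q) (fun q => mG q)
    (hG.precomp Subtype.val_injective) (fun q => lG q)
    (w := fun q => θ * (ℓ q / ℓ s))
    (fun q => mul_nonneg hθ.le (div_nonneg (hℓ _) hs.le)), negExp.add]

/-- The coverage probability at fixed path losses `ℓ` when there are several bands. -/
theorem measure_exists_lt_SINR {Ω ι K : Type*} [Countable ι] [Fintype K] [MeasurableSpace Ω]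
    {P : Measure Ω} [IsProbabilityMeasure P] {G : ι → K → Ω → ℝ} (mG : ∀ i k, Measurable (G i k))
    (hG : iIndepFun (fun p : ι × K => G p.1 p.2) P)
    (lG : ∀ i k, HasLaw (G i k) (expMeasure 1) P) {ℓ : ι → ℝ}
    (hℓ : ∀ i, 0 ≤ ℓ i) {s : ι} (hs : 0 < ℓ s) {b θ : ℝ} (hb : 0 ≤ b) (hθ : 0 < θ) :
    P {ω | ∃ k, ENNReal.ofReal θ < ENNReal.ofReal (G s k ω * ℓ s) /
        (ENNReal.ofReal b + ∑' q : {q // q ≠ s}, ENNReal.ofReal (G q k ω * ℓ q))} =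
      1 - (1 - negExp (ENNReal.ofReal (θ * b / ℓ s) +
        ∑' q : {q // q ≠ s}, ENNReal.ofReal (Real.log (1 + θ * (ℓ q / ℓ s))))) ^
          Fintype.card K := by
  set C : Set (ι → ℝ) := {g | ENNReal.ofReal θ < ENNReal.ofReal (g s * ℓ s) /
        (ENNReal.ofReal b + ∑' q : {q // q ≠ s}, ENNReal.ofReal (g q * ℓ q))} with hC
  have hCm : MeasurableSet C := by
    have : Measurable fun g : ι → ℝ => ∑' q : {q // q ≠ s}, ENNReal.ofReal (g q * ℓ q) :=
      Measurable.tsum fun q => by fun_prop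
    exact measurableSet_lt measurable_const (by fun_prop)
  have hgm : ∀ k, Measurable fun ω i => G i k ω := fun k => measurable_pi_lambda _ fun i => mG i k
  -- Regrouped by band, the fading vectors are independent and the coverage event in every band is
  -- the preimage of the same set C, so the failure probabilities multiply.
  have hgroup : iIndepFun (fun k ω i => G i k ω) P :=
    iIndepFun_curry (X := fun p : K × ι => G p.2 p.1) (fun p => mG p.2 p.1)
      (hG.precomp Prod.swap_injective)
  have hk : ∀ k, P ((fun ω i => G i k ω) ⁻¹' C) = negExp (ENNReal.ofReal (θ * b / ℓ s) +
        ∑' q : {q // q ≠ s}, ENNReal.ofReal (Real.log (1 + θ * (ℓ q / ℓ s)))) := fun k =>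
    measure_lt_SINR (fun i => mG i k)
      (hG.precomp (g := fun i => (i, k)) (Prod.mk_left_injective k)) (fun i => lG i k) hℓ hs hb hθ
  have hset : {ω | ∃ k, ENNReal.ofReal θ < ENNReal.ofReal (G s k ω * ℓ s) /
        (ENNReal.ofReal b + ∑' q : {q // q ≠ s}, ENNReal.ofReal (G q k ω * ℓ q))} =
      (⋂ k, (fun ω i => G i k ω) ⁻¹' Cᶜ)ᶜ := by
    ext ω
    simp [hC]
  rw [hset, prob_compl_eq_one_sub (MeasurableSet.iInter fun k => hgm k hCm.compl),
    hgroup.meas_iInter fun k => ⟨Cᶜ, hCm.compl, rfl⟩]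
  congr 1
  rw [← Finset.card_univ, ← Finset.prod_const]
  refine Finset.prod_congr rfl fun k _ => ?_
  rw [Set.preimage_compl, prob_compl_eq_one_sub (hgm k hCm), hk]

theorem one_sub_one_sub_pow_eq_sum (p : ℝ) (n : ℕ) :
    1 - (1 - p) ^ n = ∑ m ∈ Finset.Icc 1 n, (n.choose m : ℝ) * (-1) ^ (m + 1) * p ^ m := by
  rw [sub_eq_neg_add 1 p, add_pow, Finset.range_eq_Ico,
    Finset.sum_eq_sum_Ico_succ_bot (by omega)]
  have : Finset.Ico (0 + 1) (n + 1) = Finset.Icc 1 n := by ext; simp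
  rw [this]
  simp only [pow_zero, one_pow, mul_one, Nat.choose_zero_right, Nat.cast_one,
    sub_add_eq_sub_sub, sub_self, zero_sub, ← Finset.sum_neg_distrib]
  refine Finset.sum_congr rfl fun l _ => ?_
  rw [neg_pow]; ring

/-! ### Averaging over the locations -/

/-- The exponent with which the noise contributes to the coverage in `m` bands when the server is
at squared distance `u`. -/
noncomputable def noiseExponent (θ α b : ℝ) (m : ℕ) (u : ℝ) : ℝ := θ * u ^ (α / 2) * m * b

theorem continuous_noiseExponent (θ b : ℝ) {α : ℝ} (hα : 2 < α) (m : ℕ) :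
    Continuous (noiseExponent θ α b m) := by
  unfold noiseExponent
  have : Continuous fun u : ℝ => u ^ (α / 2) :=
    Real.continuous_rpow_const (by linarith)
  fun_prop

theorem noiseExponent_nonneg {θ b : ℝ} (hθ : 0 < θ) (hb : 0 ≤ b) (α : ℝ) (m : ℕ) {u : ℝ}
    (hu : 0 ≤ u) : 0 ≤ noiseExponent θ α b m u := by
  unfold noiseExponent; positivity

theorem monotoneOn_noiseExponent {θ α b : ℝ} (hθ : 0 < θ) (hb : 0 ≤ b) (hα : 2 < α) (m : ℕ) :
    MonotoneOn (noiseExponent θ α b m) (Set.Ici 0) := by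
  intro x hx y hy hxy
  have hx : 0 ≤ x := hx
  unfold noiseExponent
  gcongr

/-- The `m`-th power of the conditional probability of coverage in one band given the locations. -/
theorem nearestSum_eq_pow {ι : Type*} {x : ι → Plane} {s : ι}
    (hs : IsNearest (fun q => ‖x q‖ ^ 2) s) (hs0 : 0 < ‖x s‖) (θ α b : ℝ) (m : ℕ) :
    nearestSum (noiseExponent θ α b m) (interferenceExponent θ α m) Set.univ
        (fun q => ‖x q‖ ^ 2) =
      negExp (ENNReal.ofReal (θ * b / pathLoss α (x s)) + ∑' q : {q // q ≠ s},
        ENNReal.ofReal (Real.log (1 + θ * (pathLoss α (x q) / pathLoss α (x s))))) ^ m := by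
  have hsq : ∀ r : ℝ, 0 ≤ r → (r ^ 2) ^ (α / 2) = r ^ α := fun r hr => by
    rw [← Real.rpow_natCast, ← Real.rpow_mul hr]; congr 1; push_cast; ring
  rw [nearestSum_of_isNearest hs _ _ (Set.mem_univ _), ← negExp.natCast_mul, mul_add,
    ← ENNReal.ofReal_natCast, ← ENNReal.ofReal_mul (by positivity), ← ENNReal.tsum_mul_left]
  congr 2
  · rw [noiseExponent, hsq _ hs0.le, pathLoss, Real.rpow_neg hs0.le, div_inv_eq_mul]
    congr 1; ring
  · refine tsum_congr fun q => ?_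
    have hq : 0 < ‖x q‖ := by
      have : ‖x s‖ ^ 2 < ‖x q‖ ^ 2 := hs q q.2
      exact lt_of_le_of_ne (norm_nonneg _) fun h => by rw [← h] at this; nlinarith
    rw [interferenceExponent, ← div_pow, hsq _ (by positivity), pathLoss, pathLoss,
      Real.rpow_neg hs0.le, Real.rpow_neg hq.le, Real.div_rpow hs0.le hq.le, inv_div_inv,
      ENNReal.ofReal_natCast]

/-- Serving permits ties in distance, being nearest does not. A strictly nearest transmitter is the
only possible server, which makes the choice of server in the coverage event unambiguous almost
surely. -/
theorem isServing_iff_of_isNearest {N : Type*} {x : N → ℕ → Plane} {s : N × ℕ}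
    (hs : IsNearest (fun q : N × ℕ => ‖x q.1 q.2‖ ^ 2) s) (s' : N × ℕ) :
    IsServing x s' ↔ s' = s := by
  constructor
  · intro h
    by_contra hne
    exact not_lt.2 (pow_le_pow_left₀ (norm_nonneg _) (h s) 2) (hs s' hne)
  · rintro rfl q
    rcases eq_or_ne q s' with rfl | hne
    · exact le_rfl
    · exact (lt_of_pow_lt_pow_left₀ 2 (norm_nonneg _) (hs q hne)).le

/-- The locations and fadings for which `s` is strictly closest to the origin, differs from it,
and covers the user in one of the bands. -/
def coverageSet {N : Type*} (α η W θ : ℝ) (s : N × ℕ) :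
    Set ((N × ℕ × N → ℝ) × (N × ℕ → Plane)) :=
  {p | (IsNearest (fun q => ‖p.2 q‖ ^ 2) s ∧ 0 < ‖p.2 s‖) ∧
    ∃ k : N, ENNReal.ofReal θ <
      SINR α η W (fun j i => p.2 (j, i)) (fun j i l => p.1 (j, i, l)) s k}

theorem measurableSet_coverageSet {N : Type*} [Fintype N] (α η W θ : ℝ) (s : N × ℕ) :
    MeasurableSet (coverageSet α η W θ s) := by
  have h1 : Measurable fun p : (N × ℕ × N → ℝ) × (N × ℕ → Plane) => fun q => ‖p.2 q‖ ^ 2 :=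
    measurable_pi_lambda _ fun q => by fun_prop
  have h2 : MeasurableSet {p : (N × ℕ × N → ℝ) × (N × ℕ → Plane) | 0 < ‖p.2 s‖} :=
    measurableSet_lt measurable_const (by fun_prop)
  refine ((h1 (measurableSet_isNearest s)).inter h2).inter ?_
  have h3 : {p : (N × ℕ × N → ℝ) × (N × ℕ → Plane) | ∃ k : N, ENNReal.ofReal θ <
      SINR α η W (fun j i => p.2 (j, i)) (fun j i l => p.1 (j, i, l)) s k} =
      ⋃ k, {p | ENNReal.ofReal θ <
        SINR α η W (fun j i => p.2 (j, i)) (fun j i l => p.1 (j, i, l)) s k} := by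
    ext; simp
  have h4 : ∀ (q : N × ℕ) (k : N), Measurable fun p : (N × ℕ × N → ℝ) × (N × ℕ → Plane) =>
      ENNReal.ofReal (p.1 (q.1, q.2, k) * pathLoss α (p.2 (q.1, q.2))) := fun q k => by
    unfold pathLoss
    fun_prop
  refine MeasurableSet.congr (MeasurableSet.iUnion fun k => ?_) h3.symm
  refine measurableSet_lt measurable_const ?_
  have h5 : Measurable fun p : (N × ℕ × N → ℝ) × (N × ℕ → Plane) =>
      interference α (fun j i => p.2 (j, i)) (fun j i l => p.1 (j, i, l)) s k := by
    unfold interference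
    exact Measurable.tsum fun q : {q : N × ℕ // q ≠ s} => h4 q k
  exact (h4 s k).div (measurable_const.add h5)

theorem disjoint_coverageSet {N : Type*} (α η W θ : ℝ) {s s' : N × ℕ} (hne : s ≠ s') :
    Disjoint (coverageSet α η W θ s) (coverageSet α η W θ s') :=
  Set.disjoint_left.2 fun _ hp hp' => hne (hp.1.1.unique hp'.1.1)

namespace IsSharedNetwork

variable {N : Type*} [Fintype N] {Ω : Type*} [MeasurableSpace Ω] {P : Measure Ω}
  [IsProbabilityMeasure P] {lam : N → ℝ} {X : N → ℕ → Ω → Plane} {h : N → ℕ → N → Ω → ℝ}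

theorem isHalfLinePoisson [Nonempty N] (hnet : IsSharedNetwork P lam X h)
    (hlam : ∀ j, 0 < lam j) :
    IsHalfLinePoisson P (fun (q : N × ℕ) ω => ‖X q.1 q.2 ω‖ ^ 2)
      (Real.pi * ∑ j, lam j) where
  pos := mul_pos Real.pi_pos (Finset.sum_pos (fun j _ => hlam j) Finset.univ_nonempty)
  measurable q := by have := hnet.measurable_location q.1 q.2; fun_prop
  nonneg q ω := by positivity
  laplace ρ hρ := hnet.laplace_norm_sq hlam hρ

/-- Almost surely there is a unique transmitter closest to the origin, not at the origin. -/
theorem ae_exists_isNearest [Nonempty N] (hnet : IsSharedNetwork P lam X h)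
    (hlam : ∀ j, 0 < lam j) :
    ∀ᵐ ω ∂P, (∃ s, IsNearest (fun q : N × ℕ => ‖X q.1 q.2 ω‖ ^ 2) s) ∧
      ∀ q : N × ℕ, 0 < ‖X q.1 q.2 ω‖ := by
  have ht := hnet.isHalfLinePoisson hlam
  have hc := ht.pos
  set c := Real.pi * ∑ j, lam j
  refine Filter.Eventually.and ?_ ?_
  -- With γ = κ = 0 this is the indicator that a strictly nearest point exists, and its expectation
  -- is ∫ c exp(-c u) du = 1.
  · set T : Ω → ℝ≥0∞ := fun ω => nearestSum (fun _ => 0) (fun _ => 0) Set.univ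
      (fun q : N × ℕ => ‖X q.1 q.2 ω‖ ^ 2)
    have hT : Measurable T :=
      ht.measurable_nearestSum measurable_const measurable_const MeasurableSet.univ
    have hT1 : ∀ ω, T ω ≤ 1 := fun ω => nearestSum_le_one _ _ _ _
    have h1 : (∫⁻ ω, T ω ∂P).toReal = 1 := by
      rw [ht.lintegral_nearestSum continuous_const measurable_const (fun _ _ => le_rfl) rfl
        monotoneOn_const monotoneOn_const (le_refl (0 : ℝ)) (by simp), integral_const_mul]
      have : ∀ u : ℝ, Real.exp (-0 - c * u * (1 + 0)) = Real.exp (-c * u) := fun u => by ring_nf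
      simp only [this]
      rw [integral_exp_mul_Ioi (neg_neg_of_pos hc)]
      simp [hc.ne']
    have h2 : ∫⁻ ω, T ω ∂P = 1 := by
      rwa [ENNReal.toReal_eq_one_iff] at h1
    have h3 : ∫⁻ ω, (1 - T ω) ∂P = 0 := by
      rw [lintegral_sub hT (by rw [h2]; simp) (Eventually.of_forall hT1), h2]; simp
    rw [lintegral_eq_zero_iff (by fun_prop)] at h3
    filter_upwards [h3] with ω hω
    by_contra hne
    push Not at hne
    have : T ω = 0 := nearestSum_eq_zero _ _ fun s hs => absurd hs (hne s)
    simp [this] at hω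
  -- The indicator that no transmitter is at the origin; its weight vanishes on (0, ∞), so the
  -- Laplace functional gives probability 1.
  · set T : Ω → ℝ≥0∞ := fun ω =>
      negExp (∑' q : N × ℕ, if ‖X q.1 q.2 ω‖ ^ 2 ≤ 0 then ∞ else 0)
    have hρ : Measurable fun y : ℝ => if y ≤ 0 then ∞ else 0 :=
      Measurable.ite measurableSet_Iic measurable_const measurable_const
    have hT : Measurable T := negExp.measurable.comp
      (Measurable.tsum fun q => hρ.comp (ht.measurable q))
    have h2 : ∫⁻ ω, T ω ∂P = 1 := by
      refine (ht.laplace _ hρ).trans ?_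
      rw [setLIntegral_congr_fun (g := fun _ => 0) measurableSet_Ioi fun y hy => by
        simp [not_le.2 (Set.mem_Ioi.1 hy)]]
      simp
    have h3 : ∫⁻ ω, (1 - T ω) ∂P = 0 := by
      rw [lintegral_sub hT (by rw [h2]; simp) (Eventually.of_forall fun ω => negExp.le_one _),
        h2]
      simp
    rw [lintegral_eq_zero_iff (by fun_prop)] at h3
    filter_upwards [h3] with ω hω q
    by_contra hq
    have hq : ‖X q.1 q.2 ω‖ ^ 2 ≤ 0 := by
      have : ‖X q.1 q.2 ω‖ = 0 := le_antisymm (not_lt.1 hq) (norm_nonneg _)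
      rw [this]; simp
    have : T ω = 0 := by
      simp only [T]
      rw [ENNReal.tsum_eq_top_of_eq_top ⟨q, if_pos hq⟩, negExp.top]
    simp [this] at hω

open Classical in
/-- The probability that transmitter `s` is the server and covers the user. -/
theorem measure_coverageSet (hnet : IsSharedNetwork P lam X h) {α η W θ : ℝ} (hη : 0 < η)
    (hW : 0 ≤ W) (hθ : 0 < θ) (s : N × ℕ) :
    P ((fun ω => ((fun p : N × ℕ × N => h p.1 p.2.1 p.2.2 ω), fun q : N × ℕ => X q.1 q.2 ω)) ⁻¹'
        coverageSet α η W θ s) =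
      ∫⁻ ω, (if IsNearest (fun q : N × ℕ => ‖X q.1 q.2 ω‖ ^ 2) s ∧ 0 < ‖X s.1 s.2 ω‖ then
        1 - (1 - nearestSum (noiseExponent θ α (η * W) 1) (interferenceExponent θ α 1) Set.univ
          (fun q : N × ℕ => ‖X q.1 q.2 ω‖ ^ 2)) ^ Fintype.card N else 0) ∂P := by
  have hhm : Measurable fun ω => fun p : N × ℕ × N => h p.1 p.2.1 p.2.2 ω :=
    measurable_pi_lambda _ fun p => hnet.measurable_fading _ _ _
  have hXm : Measurable fun ω => fun q : N × ℕ => X q.1 q.2 ω :=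
    measurable_pi_lambda _ fun p => hnet.measurable_location _ _
  have hCm := measurableSet_coverageSet α η W θ s
  have hind := hnet.indep_fading_location
  rw [indepFun_iff_map_prod_eq_prod_map_map hhm.aemeasurable hXm.aemeasurable] at hind
  have := Measure.isProbabilityMeasure_map (μ := P) hhm.aemeasurable
  have := Measure.isProbabilityMeasure_map (μ := P) hXm.aemeasurable
  -- Fadings and locations are independent, so by Tonelli the fadings are integrated first, with the
  -- locations frozen.
  rw [← Measure.map_apply (hhm.prodMk hXm) hCm, hind, Measure.prod_apply_symm hCm,
    lintegral_map (measurable_measure_prodMk_right hCm) hXm]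
  refine lintegral_congr fun ω => ?_
  rw [Measure.map_apply hhm (measurable_prodMk_right hCm)]
  split_ifs with hs
  · have h1 : (fun ω' => fun p : N × ℕ × N => h p.1 p.2.1 p.2.2 ω') ⁻¹'
        ((fun x => (x, fun q : N × ℕ => X q.1 q.2 ω)) ⁻¹' coverageSet α η W θ s) =
        {ω' | ∃ k, ENNReal.ofReal θ <
          ENNReal.ofReal (h s.1 s.2 k ω' * pathLoss α (X s.1 s.2 ω)) /
          (ENNReal.ofReal (η * W) + ∑' q : {q : N × ℕ // q ≠ s},
            ENNReal.ofReal (h q.1.1 q.1.2 k ω' * pathLoss α (X q.1.1 q.1.2 ω)))} := by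
      ext ω'
      exact and_iff_right hs
    have hpow := nearestSum_eq_pow (x := fun q : N × ℕ => X q.1 q.2 ω) hs.1 hs.2 θ α (η * W) 1
    rw [h1, hpow, pow_one]
    exact measure_exists_lt_SINR (G := fun (q : N × ℕ) k => h q.1 q.2 k)
      (fun q k => hnet.measurable_fading _ _ _)
      (hnet.indep_fading.precomp (g := Equiv.prodAssoc N ℕ N) (Equiv.injective _))
      (fun q k => hnet.fading_law _ _ _)
      (ℓ := fun q : N × ℕ => pathLoss α (X q.1 q.2 ω))
      (fun q => Real.rpow_nonneg (norm_nonneg _) _) (Real.rpow_pos_of_pos hs.2 _)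
      (mul_nonneg hη.le hW) hθ
  · have h1 : (fun ω' => fun p : N × ℕ × N => h p.1 p.2.1 p.2.2 ω') ⁻¹'
        ((fun x => (x, fun q : N × ℕ => X q.1 q.2 ω)) ⁻¹' coverageSet α η W θ s) = ∅ := by
      ext ω'
      simp only [Set.mem_preimage, Set.mem_empty_iff_false, iff_false]
      exact fun h => hs h.1
    rw [h1, measure_empty]

/-- Coverage in terms of the conditional expectation given the locations. -/
theorem coverageProbability_eq_sum [Nonempty N] (hnet : IsSharedNetwork P lam X h)
    (hlam : ∀ j, 0 < lam j) {α η W θ : ℝ} (hα : 2 < α) (hη : 0 < η)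
    (hW : 0 ≤ W) (hθ : 0 < θ) :
    coverageProbability P α η W θ X h =
      ∑ m ∈ Finset.Icc 1 (Fintype.card N), ((Fintype.card N).choose m : ℝ) * (-1) ^ (m + 1) *
        (∫⁻ ω, nearestSum (noiseExponent θ α (η * W) m) (interferenceExponent θ α m) Set.univ
          (fun q : N × ℕ => ‖X q.1 q.2 ω‖ ^ 2) ∂P).toReal := by
  classical
  have ht := hnet.isHalfLinePoisson hlam
  have hgood := hnet.ae_exists_isNearest hlam
  have hhm : Measurable fun ω => fun p : N × ℕ × N => h p.1 p.2.1 p.2.2 ω :=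
    measurable_pi_lambda _ fun p => hnet.measurable_fading _ _ _
  have hXm : Measurable fun ω => fun q : N × ℕ => X q.1 q.2 ω :=
    measurable_pi_lambda _ fun p => hnet.measurable_location _ _
  set V : Ω → (N × ℕ × N → ℝ) × (N × ℕ → Plane) := fun ω =>
    ((fun p : N × ℕ × N => h p.1 p.2.1 p.2.2 ω), fun q : N × ℕ => X q.1 q.2 ω) with hV
  have hVm : Measurable V := hhm.prodMk hXm
  set T : ℕ → Ω → ℝ≥0∞ := fun m ω => nearestSum (noiseExponent θ α (η * W) m)
    (interferenceExponent θ α m) Set.univ (fun q : N × ℕ => ‖X q.1 q.2 ω‖ ^ 2) with hT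
  have hTm : ∀ m, Measurable (T m) := fun m =>
    ht.measurable_nearestSum (continuous_noiseExponent θ _ hα m).measurable
      (measurable_interferenceExponent θ α m) MeasurableSet.univ
  have hT1 : ∀ m ω, T m ω ≤ 1 := fun m ω => nearestSum_le_one _ _ _ _
  set n := Fintype.card N
  -- Up to a null set the server is the unique nearest transmitter, so coverage is a countable
  -- disjoint union over its index.
  have hcov : P {ω | ∃ s : N × ℕ, IsServing (fun j i => X j i ω) s ∧ ∃ k : N,
      ENNReal.ofReal θ < SINR α η W (fun j i => X j i ω) (fun j i l => h j i l ω) s k} =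
      P (⋃ s, V ⁻¹' coverageSet α η W θ s) := by
    refine measure_congr ?_
    filter_upwards [hgood] with ω hω
    obtain ⟨⟨s, hs⟩, h0⟩ := hω
    refine propext ?_
    change (∃ s' : N × ℕ, IsServing (fun j i => X j i ω) s' ∧ _) ↔ ω ∈ ⋃ s, _
    rw [Set.mem_iUnion]
    constructor
    · rintro ⟨s', hs', hk⟩
      obtain rfl := (isServing_iff_of_isNearest (x := fun j i => X j i ω) hs s').1 hs'
      exact ⟨s', ⟨hs, h0 s'⟩, hk⟩
    · rintro ⟨s', ⟨hs', _⟩, hk⟩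
      exact ⟨s', (isServing_iff_of_isNearest (x := fun j i => X j i ω) hs' s').2 rfl, hk⟩
  have hdisj : Pairwise (Function.onFun Disjoint fun s => V ⁻¹' coverageSet α η W θ s) :=
    fun s s' hne => (disjoint_coverageSet α η W θ hne).preimage V
  have hYm : ∀ s : N × ℕ, Measurable fun ω =>
      (if IsNearest (fun q : N × ℕ => ‖X q.1 q.2 ω‖ ^ 2) s ∧ 0 < ‖X s.1 s.2 ω‖ then
        1 - (1 - T 1 ω) ^ n else 0) := fun s =>
    Measurable.ite ((ht.measurable_pi (measurableSet_isNearest s)).inter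
      (measurableSet_lt measurable_const (hnet.measurable_location s.1 s.2).norm))
      (measurable_const.sub ((measurable_const.sub (hTm 1)).pow_const n)) measurable_const
  have hP : P {ω | ∃ s : N × ℕ, IsServing (fun j i => X j i ω) s ∧ ∃ k : N,
      ENNReal.ofReal θ < SINR α η W (fun j i => X j i ω) (fun j i l => h j i l ω) s k} =
      ∫⁻ ω, (1 - (1 - T 1 ω) ^ n) ∂P := by
    rw [hcov, measure_iUnion hdisj fun s => hVm (measurableSet_coverageSet α η W θ s)]
    simp only [hV, fun s => hnet.measure_coverageSet (α := α) hη hW hθ s]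
    rw [← lintegral_tsum fun s => (hYm s).aemeasurable]
    refine lintegral_congr_ae ?_
    filter_upwards [hgood] with ω hω
    obtain ⟨⟨s, hs⟩, h0⟩ := hω
    rw [tsum_eq_single s, if_pos ⟨hs, h0 s⟩]
    intro s' hs'
    rw [if_neg]
    exact fun h => hs' (h.1.unique hs)
  -- Almost surely T m is the m-th power of the one-band probability T 1. The expansion alternates
  -- in sign, hence the passage from `ℝ≥0∞` to real numbers.
  have hpow : ∀ᵐ ω ∂P, (1 - (1 - T 1 ω) ^ n).toReal =
      ∑ m ∈ Finset.Icc 1 n, (n.choose m : ℝ) * (-1) ^ (m + 1) * (T m ω).toReal := by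
    filter_upwards [hgood] with ω hω
    obtain ⟨⟨s, hs⟩, h0⟩ := hω
    have h1 : ∀ m, T m ω = T 1 ω ^ m := by
      intro m
      simp only [hT]
      rw [nearestSum_eq_pow (x := fun q : N × ℕ => X q.1 q.2 ω) hs (h0 s) θ α (η * W) m, nearestSum_eq_pow (x := fun q : N × ℕ => X q.1 q.2 ω) hs (h0 s) θ α (η * W) 1, pow_one]
    rw [ENNReal.toReal_sub_of_le (pow_le_one₀ zero_le tsub_le_self) ENNReal.one_ne_top,
      ENNReal.toReal_pow, ENNReal.toReal_sub_of_le (hT1 1 ω) ENNReal.one_ne_top,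
      ENNReal.toReal_one, one_sub_one_sub_pow_eq_sum]
    refine Finset.sum_congr rfl fun m _ => ?_
    rw [h1 m, ENNReal.toReal_pow]
  have hTfin : ∀ m ω, T m ω < ∞ := fun m ω => (hT1 m ω).trans_lt ENNReal.one_lt_top
  have hint : ∀ m, Integrable (fun ω => (T m ω).toReal) P := fun m => by
    refine integrable_toReal_of_lintegral_ne_top (hTm m).aemeasurable ?_
    refine ne_top_of_le_ne_top ENNReal.one_ne_top ((lintegral_mono (hT1 m)).trans ?_)
    simp
  rw [coverageProbability, measureReal_def, hP, ← integral_toReal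
    (show Measurable fun ω => 1 - (1 - T 1 ω) ^ n from
      measurable_const.sub ((measurable_const.sub (hTm 1)).pow_const n)).aemeasurable
    (Eventually.of_forall fun ω => tsub_le_self.trans_lt ENNReal.one_lt_top),
    integral_congr_ae hpow, integral_finsetSum _ fun m _ => (hint m).const_mul _]
  refine Finset.sum_congr rfl fun m _ => ?_
  rw [integral_const_mul, integral_toReal (hTm m).aemeasurable (Eventually.of_forall (hTfin m))]

end IsSharedNetwork

/-! ### The coverage formula -/

theorem proposition5 {N : Type*} [Fintype N] [Nonempty N]
    {Ω : Type*} [MeasurableSpace Ω] (P : Measure Ω) [IsProbabilityMeasure P]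
    (lam : N → ℝ) (hlam : ∀ j, 0 < lam j)
    (X : N → ℕ → Ω → Plane) (h : N → ℕ → N → Ω → ℝ) (hnet : IsSharedNetwork P lam X h)
    (α η W θ : ℝ) (hα : 2 < α) (hη : 0 < η) (hW : 0 ≤ W) (hθ : 0 < θ) :
    (∀ k ∈ Finset.Icc 1 (Fintype.card N),
      IntegrableOn (fun r : ℝ => Real.exp (-(θ * r ^ (α / 2) * k * (η * W))) *
        Real.exp (-(Real.pi * r * ∑ j, lam j *
          (1 + ∑ l ∈ Finset.Icc 1 k, (k.choose l : ℝ) * (-1) ^ (l + 1) * interferenceZ θ α l))))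
        (Set.Ioi 0)) ∧
    coverageProbability P α η W θ X h =
      Real.pi * (∑ i, lam i) *
        ∑ k ∈ Finset.Icc 1 (Fintype.card N), ((Fintype.card N).choose k : ℝ) * (-1) ^ (k + 1) *
          ∫ r in Set.Ioi (0 : ℝ), Real.exp (-(θ * r ^ (α / 2) * k * (η * W))) *
            Real.exp (-(Real.pi * r * ∑ j, lam j *
              (1 + ∑ l ∈ Finset.Icc 1 k,
                (k.choose l : ℝ) * (-1) ^ (l + 1) * interferenceZ θ α l))) := by
  have ht := hnet.isHalfLinePoisson hlam
  have hc := ht.pos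
  have hb : 0 ≤ η * W := mul_nonneg hη.le hW
  set c := Real.pi * ∑ i, lam i with hcdef
  -- The factor 1 + z does not depend on the operator, so the sum over j collapses to c and the
  -- integrand becomes that of `IsHalfLinePoisson.lintegral_nearestSum`.
  have hform : ∀ (k : ℕ) (r : ℝ), Real.exp (-(θ * r ^ (α / 2) * k * (η * W))) *
      Real.exp (-(Real.pi * r * ∑ j, lam j * (1 + ∑ l ∈ Finset.Icc 1 k,
        (k.choose l : ℝ) * (-1) ^ (l + 1) * interferenceZ θ α l))) =
      Real.exp (-noiseExponent θ α (η * W) k r - c * r * (1 + ∑ l ∈ Finset.Icc 1 k,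
        (k.choose l : ℝ) * (-1) ^ (l + 1) * interferenceZ θ α l)) := by
    intro k r
    rw [← Real.exp_add, ← Finset.sum_mul, noiseExponent, hcdef]
    ring_nf
  simp only [hform]
  constructor
  · intro k _
    have hz := (lintegral_interferenceExponent hθ hα k).1
    set z := ∑ l ∈ Finset.Icc 1 k, (k.choose l : ℝ) * (-1) ^ (l + 1) * interferenceZ θ α l
    have hcont := continuous_noiseExponent θ (η * W) hα k
    -- Noise exponent and z are nonnegative, so exp(-c r) dominates.
    refine Integrable.mono' (exp_neg_integrableOn_Ioi 0 hc)
      (Continuous.aestronglyMeasurable (by fun_prop)) ?_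
    refine (ae_restrict_iff' measurableSet_Ioi).2 (Eventually.of_forall fun r hr => ?_)
    have hr : 0 < r := hr
    rw [Real.norm_of_nonneg (Real.exp_pos _).le, Real.exp_le_exp]
    have h1 := noiseExponent_nonneg hθ hb α k hr.le
    have h2 : 0 ≤ c * r * z := by positivity
    nlinarith
  · rw [hnet.coverageProbability_eq_sum hlam hα hη hW hθ, Finset.mul_sum]
    refine Finset.sum_congr rfl fun k _ => ?_
    obtain ⟨hz0, hz⟩ := lintegral_interferenceExponent hθ hα k
    rw [ht.lintegral_nearestSum (continuous_noiseExponent θ (η * W) hα k)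
      (measurable_interferenceExponent θ α k) (fun u hu => noiseExponent_nonneg hθ hb α k hu)
      (interferenceExponent_zero θ hα k) (monotoneOn_noiseExponent hθ hb hα k)
      (monotoneOn_interferenceExponent hθ hα k) hz0 hz, integral_const_mul]
    ring
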